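/- **Setting.** Let $d\ge 1$, let $\mathcal D$ be a probability distribution of samples $\xi$, let $f_\xi:\mathbb R^d\to\mathbb R$ be random losses with expected loss $f(x)=\mathbb E_{\xi\sim\mathcal D}[f_\xi(x)]$, and let $\|\cdot\|$ be the Euclidean norm. Let $L,\sigma>0$, $\alpha\in(1,2]$, $x^0,x^\star\in\mathbb R^d$, $R\ge\|x^0-x^\star\|$ and $Q=\{x:\|x-x^\star\|\le 2R\}$. Assume that $x^\star$ minimizes $f$ over $Q$ (for instance, over $\mathbb R^d$), that $f$ is differentiable at the points of $Q$, and that for all $x,y\in Q$ $$\|\nabla f(x)-\nabla f(y)\|\le L\|x-y\|,\qquad f(y)\ge f(x)+\langle\nabla f(x),y-x\rangle,$$ $$\mathbb E_\xi[\nabla f_\xi(x)]=\nabla f(x),\qquad \mathbb E_\xi\|\nabla f_\xi(x)-\nabla f(x)\|^\alpha\le\sigma^\alpha .$$ DP-Clipped-SGD with step-size $\gamma$, clipping level $\lambda>0$ and noise scale $\sigma_\omega$ is the recursion $$x^{k+1}=x^k-\gamma\big(\mathrm{clip}(\nabla f_{\xi^k}(x^k),\lambda)+\omega_k\big),\qquad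 \mathrm{clip}(v,\lambda)=\min\{1,\lambda/\|v\|\}\,v,$$ with $\xi^k\sim\mathcal D$, $\omega_k\sim\mathcal N(0,\sigma_\omega^2 I_d)$, all independent. Put $$\zeta_\lambda=\max\{0,2LR-\tfrac\lambda2\},\qquad S=\sigma^\alpha+\zeta_\lambda^\alpha,\qquad B=\frac{LR}{\lambda}+\frac{\lambda^{\alpha-1}\zeta_\lambda}{S}+\sigma S^{-1/\alpha}.$$ **Statement.** For every $A>0$ there is $c_0>0$ such that for all $c\in(0,c_0]$ and all $0<a_1\le a_2$ there is $C>0$ with the following property, for every problem and algorithm as above (the constants depend on nothing else). Let $K\ge1$ be an integer, $\beta\in(0,1]$, $\varepsilon>0$, $\delta\in(0,1)$; let the clipping level satisfy $$\lambda^\alpha\ln\tfrac K\beta\le A^\alpha K S$$ (which holds in particular if $\lambda\le A\sigma\,(K/\ln\frac K\beta)^{1/\alpha}$); let $\sigma_\omega=\Theta\big(\frac\lambda\varepsilon\sqrt{K\ln\frac K\delta\ln\frac1\delta}\big)$ in the sense that $$a_1\,\frac{\lambda}{\varepsilon}\sqrt{K\ln\tfrac K\delta\ln\tfrac1\delta}\;\le\;\sigma_\omega\;\le\;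 a_2\,\frac{\lambda}{\varepsilon}\sqrt{K\ln\tfrac K\delta\ln\tfrac1\delta},$$ and let $$\gamma=c\,\min\left\{\frac1L,\ \frac{R}{\lambda^{1-\alpha/2}\sqrt{K\ln(\frac K\beta)\,S}},\ \frac{R\lambda^{\alpha-1}}{K S B},\ \frac{R}{\sigma_\omega\sqrt{dK\ln\frac K\beta}}\right\}.$$ Then, with probability at least $1-\beta$, $$\min_{0\le t\le K}f(x^t)-f(x^\star)\le C\max\{T_1,T_2,T_3,T_4\},$$ where $$T_1=\frac{LR^2}{K}+\frac{L^3R^4}{\lambda^2K^2},\qquad T_2=R\lambda^{1-\alpha/2}\sqrt{\frac{S\ln(K/\beta)}{K}}+\frac{LR^2 S\ln(K/\beta)}{\lambda^{\alpha}K},$$ $$T_3=\frac{R S B}{\lambda^{\alpha-1}}+\frac{R^2L\,S^2B^2}{\lambda^{2\alpha}},\qquad T_4=\frac{R\lambda}{\varepsilon}\sqrt{d\ln\tfrac K\beta\ln\tfrac K\delta\ln\tfrac1\delta}+\frac{LR^2d\,\ln\frac K\beta\ln\frac K\delta\ln\frac1\delta}{\varepsilon^2}.$$ (For $K=\beta=1$,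 where $\ln(K/\beta)=0$, the claim is void, since $1-\beta=0$.) -/

import Mathlib

open MeasureTheory ProbabilityTheory
open scoped Gradient

namespace DPClippedSGD

noncomputable section

/-- The space `ℝ^d` with its Euclidean norm. -/
abbrev Vec (d : ℕ) : Type := EuclideanSpace ℝ (Fin d)

/-- The clipping operator `clip(v, lam) = min {1, lam / ‖v‖} v` (and `clip(0, lam) = 0`). -/
def clip {d : ℕ} (v : Vec d) (lam : ℝ) : Vec d := min 1 (lam / ‖v‖) • v

/-- The expected loss `f(x) = 𝔼_{ξ ∼ D} [ℓ_ξ(x)]`. -/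
def objective {d : ℕ} {Ξ : Type*} [MeasurableSpace Ξ] (D : Measure Ξ) (ℓ : Ξ → Vec d → ℝ)
    (x : Vec d) : ℝ :=
  ∫ ξ, ℓ ξ x ∂D

/-- The DP noise distribution: the centred Gaussian on `ℝ^d` with covariance `s² I_d`. -/
def gaussianNoise (d : ℕ) (s : ℝ) : Measure (Vec d) :=
  multivariateGaussian 0 ((s ^ 2) • (1 : Matrix (Fin d) (Fin d) ℝ))

/-- The iterates of DP-Clipped-SGD along one sequence of samples `ξ` and noise vectors `w`:
`x^{k+1} = x^k - γ (clip(∇ℓ_{ξ^k}(x^k), lam) + w_k)`. -/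
def iterate {d : ℕ} {Ξ : Type*} (ℓ : Ξ → Vec d → ℝ) (γ lam : ℝ) (x₀ : Vec d)
    (ξ : ℕ → Ξ) (w : ℕ → Vec d) : ℕ → Vec d
  | 0 => x₀
  | k + 1 =>
      iterate ℓ γ lam x₀ ξ w k - γ • (clip (∇ (ℓ (ξ k)) (iterate ℓ γ lam x₀ ξ w k)) lam + w k)

/-- `min_{t ∈ {0, …, K}} f(x^t)`. -/
def bestValue {d : ℕ} (f : Vec d → ℝ) (x : ℕ → Vec d) (K : ℕ) : ℝ :=
  (Finset.range (K + 1)).inf' Finset.nonempty_range_add_one (fun t => f (x t))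

/-- `f` is differentiable at the points of `Q` and its gradient is `L`-Lipschitz on `Q`. -/
def SmoothOn {d : ℕ} (f : Vec d → ℝ) (L : ℝ) (Q : Set (Vec d)) : Prop :=
  (∀ x ∈ Q, DifferentiableAt ℝ f x) ∧ ∀ x ∈ Q, ∀ y ∈ Q, ‖∇ f x - ∇ f y‖ ≤ L * ‖x - y‖

/-- First-order convexity of `f` on `Q`. -/
def FirstOrderConvexOn {d : ℕ} (f : Vec d → ℝ) (Q : Set (Vec d)) : Prop :=
  ∀ x ∈ Q, ∀ y ∈ Q, f x + inner ℝ (∇ f x) (y - x) ≤ f y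

/-- On `Q` the stochastic gradient is unbiased and its central moment of order `α` is at most
`σ ^ α`. -/
def HeavyTailedOracle {d : ℕ} {Ξ : Type*} [MeasurableSpace Ξ] (D : Measure Ξ)
    (ℓ : Ξ → Vec d → ℝ) (σ α : ℝ) (Q : Set (Vec d)) : Prop :=
  ∀ x ∈ Q,
    (Integrable (fun ξ => ∇ (ℓ ξ) x) D ∧ ∫ ξ, ∇ (ℓ ξ) x ∂D = ∇ (objective D ℓ) x) ∧
    (Integrable (fun ξ => ‖∇ (ℓ ξ) x - ∇ (objective D ℓ) x‖ ^ α) D ∧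
      ∫ ξ, ‖∇ (ℓ ξ) x - ∇ (objective D ℓ) x‖ ^ α ∂D ≤ σ ^ α)

/-- `ζ_lam = max {0, 2 L R - lam / 2}`. -/
def zeta (L R lam : ℝ) : ℝ := max 0 (2 * L * R - lam / 2)

/-- `S = σ^α + ζ_lam^α`. -/
def effNoise (L R σ α lam : ℝ) : ℝ := σ ^ α + zeta L R lam ^ α

/-- `B = L R / lam + lam^(α-1) ζ_lam / S + σ S^(-1/α)`. -/
def biasFactor (L R σ α lam : ℝ) : ℝ :=
  L * R / lam + lam ^ (α - 1) * zeta L R lam / effNoise L R σ α lam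
    + σ * effNoise L R σ α lam ^ (-1 / α)

/-- The minimum in the step-size condition. -/
def stepSizeMin (d K : ℕ) (L R σ α lam β σω : ℝ) : ℝ :=
  min (min (1 / L)
      (R / (lam ^ (1 - α / 2) * √(K * Real.log (K / β) * effNoise L R σ α lam))))
    (min (R * lam ^ (α - 1) / (K * effNoise L R σ α lam * biasFactor L R σ α lam))
      (R / (σω * √(d * K * Real.log (K / β)))))

/-- The DP noise scale `(lam / ε) √(K ln(K/δ) ln(1/δ))`. -/
def dpScale (K : ℕ) (lam ε δ : ℝ) : ℝ :=
  lam / ε * √(K * Real.log (K / δ) * Real.log (1 / δ))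

/-- The deterministic decreasing term. -/
def detTerm (K : ℕ) (L R lam : ℝ) : ℝ :=
  L * R ^ 2 / K + L ^ 3 * R ^ 4 / (lam ^ 2 * K ^ 2)

/-- The stochastic decreasing term. -/
def stochTerm (K : ℕ) (L R σ α lam β : ℝ) : ℝ :=
  R * lam ^ (1 - α / 2) * √(effNoise L R σ α lam * Real.log (K / β) / K)
    + L * R ^ 2 * effNoise L R σ α lam * Real.log (K / β) / (lam ^ α * K)

/-- The clipping-bias neighbourhood. -/
def biasTerm (L R σ α lam : ℝ) : ℝ :=
  R * effNoise L R σ α lam * biasFactor L R σ α lam / lam ^ (α - 1)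
    + R ^ 2 * L * effNoise L R σ α lam ^ 2 * biasFactor L R σ α lam ^ 2 / lam ^ (2 * α)

/-- The DP-noise neighbourhood. -/
def dpTerm (d K : ℕ) (L R lam β ε δ : ℝ) : ℝ :=
  R * lam / ε * √(d * Real.log (K / β) * Real.log (K / δ) * Real.log (1 / δ))
    + L * R ^ 2 * d * Real.log (K / β) * Real.log (K / δ) * Real.log (1 / δ) / ε ^ 2

end

end DPClippedSGD

/-!
As long as the iterates stay in the ball of radius `3 / 2 * R` around `xstar`, the stochastic
gradients have mean at most `lam / 2 + zeta L R lam`, so clipping at `lam` creates a bias of order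
`clipBias` and leaves a fluctuation bounded by `2 * lam` whose variance is of order
`lam ^ (2 - α) * effNoise`. One step changes `‖x - xstar‖ ^ 2` by at most `-γ (f x - f xstar)`
plus the contributions of bias, fluctuation and Gaussian noise. The noise contributions are set to
zero outside of the ball. What remains has, conditionally on the past, an exponential moment of at
most `exp (l / K)` at the scale `4 * l / R ^ 2` with `l = log (K / β)`, so by Chernoff's bound for
each partial sum and a union bound all partial sums stay below `R ^ 2 / 2` with probability at
least `1 - K * exp (-l) = 1 - β`. On that event the iterates never leave the ball, and telescoping
gives `∑ γ (f x - f xstar) ≤ (3 / 2 * R) ^ 2`.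
-/

namespace DPClippedSGD

section Clipping

variable {d : ℕ} {lam : ℝ}

lemma clip_of_norm_le {v : Vec d} (hv : ‖v‖ ≤ lam) : clip v lam = v := by
  rcases eq_or_ne v 0 with rfl | hv0
  · simp [clip]
  · rw [clip, min_eq_left ((one_le_div (norm_pos_iff.2 hv0)).2 hv), one_smul]

lemma clip_of_le_norm {v : Vec d} (hlam : 0 < lam) (hv : lam ≤ ‖v‖) :
    clip v lam = (lam / ‖v‖) • v := by
  rw [clip, min_eq_right ((div_le_one (hlam.trans_le hv)).2 hv)]

lemma norm_clip_le (hlam : 0 < lam) (v : Vec d) : ‖clip v lam‖ ≤ lam := by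
  rcases le_total ‖v‖ lam with hv | hv
  · rwa [clip_of_norm_le hv]
  · have hv0 : 0 < ‖v‖ := hlam.trans_le hv
    rw [clip_of_le_norm hlam hv, norm_smul, Real.norm_of_nonneg (by positivity),
      div_mul_cancel₀ _ hv0.ne']

lemma norm_clip_sub_self (hlam : 0 < lam) (v : Vec d) :
    ‖clip v lam - v‖ = max 0 (‖v‖ - lam) := by
  rcases le_total ‖v‖ lam with hv | hv
  · rw [clip_of_norm_le hv, sub_self, norm_zero, max_eq_left (by linarith)]
  · have hv0 : 0 < ‖v‖ := hlam.trans_le hv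
    have hsub : (lam / ‖v‖) • v - v = (lam / ‖v‖ - 1) • v := by rw [sub_smul, one_smul]
    have hcoef : lam / ‖v‖ - 1 ≤ 0 := by rwa [sub_nonpos, div_le_one hv0]
    rw [clip_of_le_norm hlam hv, max_eq_right (by linarith), hsub, norm_smul,
      Real.norm_of_nonpos hcoef]
    field_simp
    ring

/-- Clipping at level `lam` is the metric projection onto the ball of radius `lam`: this is the
variational inequality characterizing the projection. -/
lemma inner_sub_clip_clip_sub_nonneg (hlam : 0 < lam) (v : Vec d) {u : Vec d} (hu : ‖u‖ ≤ lam) :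
    0 ≤ inner ℝ (v - clip v lam) (clip v lam - u) := by
  rcases le_total ‖v‖ lam with hv | hv
  · simp [clip_of_norm_le hv]
  · have hv0 : 0 < ‖v‖ := hlam.trans_le hv
    have hsub : v - (lam / ‖v‖) • v = (1 - lam / ‖v‖) • v := by rw [sub_smul, one_smul]
    have hvu : inner ℝ v u ≤ lam * ‖v‖ := by
      rw [mul_comm]
      exact (real_inner_le_norm v u).trans (by gcongr)
    have hvv : lam / ‖v‖ * ‖v‖ ^ 2 = lam * ‖v‖ := by field_simp
    rw [clip_of_le_norm hlam hv, hsub, inner_smul_left, inner_sub_right, inner_smul_right,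
      real_inner_self_eq_norm_sq, hvv]
    exact mul_nonneg (sub_nonneg.2 ((div_le_one hv0).2 hv)) (sub_nonneg.2 hvu)

lemma norm_clip_sub_clip_le (hlam : 0 < lam) (x y : Vec d) :
    ‖clip x lam - clip y lam‖ ≤ ‖x - y‖ := by
  have hx := inner_sub_clip_clip_sub_nonneg hlam x (norm_clip_le hlam y)
  have hy := inner_sub_clip_clip_sub_nonneg hlam y (norm_clip_le hlam x)
  set p := clip x lam - clip y lam with hp
  have hexpand : inner ℝ (x - y) p - ‖p‖ ^ 2
      = inner ℝ (x - clip x lam) p + inner ℝ (y - clip y lam) (clip y lam - clip x lam) := by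
    rw [← real_inner_self_eq_norm_sq, ← inner_sub_left, ← neg_sub (clip x lam) (clip y lam), ← hp,
      inner_neg_right, ← sub_eq_add_neg, ← inner_sub_left]
    congr 1
    rw [hp]
    abel
  have hle : ‖p‖ * ‖p‖ ≤ ‖x - y‖ * ‖p‖ := by
    linarith [real_inner_le_norm (x - y) p]
  rcases (norm_nonneg p).eq_or_lt with h0 | h0
  · rw [← h0]; positivity
  · exact le_of_mul_le_mul_right hle h0

lemma measurable_clip : Measurable fun v : Vec d => clip v lam := by
  unfold clip
  fun_prop

variable {Ξ : Type*} [MeasurableSpace Ξ] {D : Measure Ξ} {X : Ξ → Vec d}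

lemma integrable_clip [IsFiniteMeasure D] (hX : AEStronglyMeasurable X D) (hlam : 0 < lam) :
    Integrable (fun ξ => clip (X ξ) lam) D :=
  .of_bound (measurable_clip.comp_aemeasurable hX.aemeasurable).aestronglyMeasurable
    lam (.of_forall fun _ => norm_clip_le hlam _)

lemma sub_le_rpow_mul_rpow {y a α : ℝ} (hy : 0 ≤ y) (ha : 0 < a) (hα : 1 ≤ α) :
    y - a ≤ a ^ (1 - α) * y ^ α := by
  rcases le_or_gt y a with hya | hay
  · exact (sub_nonpos.2 hya).trans (by positivity)
  · have hy0 : 0 < y := ha.trans hay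
    calc y - a ≤ y ^ (1 - α) * y ^ α := by rw [← Real.rpow_add hy0]; simp [ha.le]
      _ ≤ a ^ (1 - α) * y ^ α := by
        gcongr ?_ * _
        exact Real.rpow_le_rpow_of_nonpos ha hay.le (by linarith)

variable [IsProbabilityMeasure D]

/-- The bias is `𝔼[clip X - X]`, which is nonzero only if `X` deviates from its mean by at least
`lam / 2` up to the shift `z`. -/
lemma norm_integral_clip_sub_integral_le {α s z : ℝ} (hX : Integrable X D) (hlam : 0 < lam)
    (hα : 1 ≤ α) (hα2 : α ≤ 2) (hz : 0 ≤ z) (hmz : ‖∫ ξ, X ξ ∂D‖ ≤ lam / 2 + z)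
    (hY : Integrable (fun ξ => ‖X ξ - ∫ η, X η ∂D‖ ^ α) D)
    (hs : ∫ ξ, ‖X ξ - ∫ η, X η ∂D‖ ^ α ∂D ≤ s) :
    ‖∫ ξ, clip (X ξ) lam ∂D - ∫ ξ, X ξ ∂D‖ ≤ z + 2 * lam ^ (1 - α) * s := by
  set m := ∫ ξ, X ξ ∂D
  have hpt (ξ : Ξ) : ‖clip (X ξ) lam - X ξ‖ ≤ z + (lam / 2) ^ (1 - α) * ‖X ξ - m‖ ^ α := by
    rw [norm_clip_sub_self hlam]
    have hdev := sub_le_rpow_mul_rpow (norm_nonneg (X ξ - m)) (half_pos hlam) hα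
    have htri : ‖X ξ‖ ≤ ‖X ξ - m‖ + ‖m‖ := norm_le_norm_sub_add _ _
    exact max_le (by positivity) (by linarith)
  have hpow : (lam / 2) ^ (1 - α) ≤ 2 * lam ^ (1 - α) := by
    rw [Real.div_rpow hlam.le zero_le_two, div_eq_mul_inv, ← Real.rpow_neg zero_le_two, mul_comm]
    gcongr
    exact Real.rpow_le_self_of_one_le one_le_two (by linarith)
  have : 0 ≤ s := (integral_nonneg fun ξ => by positivity).trans hs
  calc ‖∫ ξ, clip (X ξ) lam ∂D - m‖ = ‖∫ ξ, (clip (X ξ) lam - X ξ) ∂D‖ := by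
        rw [integral_sub (integrable_clip hX.1 hlam) hX]
    _ ≤ ∫ ξ, (z + (lam / 2) ^ (1 - α) * ‖X ξ - m‖ ^ α) ∂D :=
        norm_integral_le_of_norm_le ((integrable_const z).add (hY.const_mul _)) (.of_forall hpt)
    _ = z + (lam / 2) ^ (1 - α) * ∫ ξ, ‖X ξ - m‖ ^ α ∂D := by
        rw [integral_add (integrable_const z) (hY.const_mul _), integral_const_mul,
          integral_const, probReal_univ, one_smul]
    _ ≤ z + (2 * lam ^ (1 - α)) * s := by gcongr

end Clipping

section Moments

variable {E : Type*} [NormedAddCommGroup E] [InnerProductSpace ℝ E]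

/-- `e ^ y ≤ 1 + y + y ^ 2` for `|y| ≤ 1`. -/
lemma exp_inner_add_norm_sq_le {M p q : ℝ} {u v : E} (hv : ‖v‖ ≤ M) (hp : 0 ≤ p) (hq : 0 ≤ q)
    (hpq : p * ‖u‖ * M + q * M ^ 2 ≤ 1) :
    Real.exp (-p * inner ℝ u v + q * ‖v‖ ^ 2)
      ≤ 1 + -p * inner ℝ u v + (2 * p ^ 2 * ‖u‖ ^ 2 + 3 * q) * ‖v‖ ^ 2 := by
  have hM : 0 ≤ M := (norm_nonneg v).trans hv
  have hlin : |-p * inner ℝ u v| ≤ p * ‖u‖ * ‖v‖ := by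
    rw [abs_mul, abs_neg, abs_of_nonneg hp, mul_assoc]
    gcongr
    exact abs_real_inner_le_norm u v
  have hquad : q * ‖v‖ ^ 2 ≤ 1 := by
    have : 0 ≤ p * ‖u‖ * M := by positivity
    have : q * ‖v‖ ^ 2 ≤ q * M ^ 2 := by gcongr
    linarith
  have hsmall : |-p * inner ℝ u v + q * ‖v‖ ^ 2| ≤ 1 :=
    calc _ ≤ |-p * inner ℝ u v| + |q * ‖v‖ ^ 2| := abs_add_le _ _
      _ ≤ p * ‖u‖ * M + q * M ^ 2 := by
        rw [abs_of_nonneg (by positivity : 0 ≤ q * ‖v‖ ^ 2)]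
        gcongr
        exact hlin.trans (by gcongr)
      _ ≤ 1 := hpq
  have hexp := (abs_le.1 (Real.abs_exp_sub_one_sub_id_le hsmall)).2
  have hlin_sq : (-p * inner ℝ u v) ^ 2 ≤ p ^ 2 * ‖u‖ ^ 2 * ‖v‖ ^ 2 := by
    rw [← sq_abs, ← mul_pow, ← mul_pow]
    gcongr
  have hquad_sq : (q * ‖v‖ ^ 2) ^ 2 ≤ q * ‖v‖ ^ 2 := by
    rw [sq]
    exact mul_le_of_le_one_left (by positivity) hquad
  have hsq := add_sq_le (a := -p * inner ℝ u v) (b := q * ‖v‖ ^ 2)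
  linarith

variable [CompleteSpace E] {Ξ : Type*} [MeasurableSpace Ξ] {D : Measure Ξ}
  [IsProbabilityMeasure D]

lemma integral_norm_sub_integral_sq_le {W : Ξ → E} (hW : MemLp W 2 D) (a : E) :
    ∫ ξ, ‖W ξ - ∫ η, W η ∂D‖ ^ 2 ∂D ≤ ∫ ξ, ‖W ξ - a‖ ^ 2 ∂D := by
  set m := ∫ η, W η ∂D with hm
  have hsq (b : E) : Integrable (fun ξ => ‖W ξ - b‖ ^ 2) D :=
    (hW.sub (memLp_const b)).integrable_norm_pow two_ne_zero
  have hcentred : Integrable (fun ξ => W ξ - m) D :=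
    (hW.integrable one_le_two).sub (integrable_const m)
  have hcross : ∫ ξ, inner ℝ (m - a) (W ξ - m) ∂D = 0 := by
    rw [integral_inner hcentred, integral_sub (hW.integrable one_le_two) (integrable_const m)]
    simp [hm]
  have hpt (ξ : Ξ) : ‖W ξ - m‖ ^ 2 + 2 * inner ℝ (m - a) (W ξ - m) ≤ ‖W ξ - a‖ ^ 2 := by
    rw [← sub_add_sub_cancel (W ξ) m a, norm_add_sq_real, real_inner_comm]
    linarith [sq_nonneg ‖m - a‖]
  have hint := integral_mono ((hsq m).add ((hcentred.const_inner (m - a)).const_mul 2)) (hsq a) hpt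
  rw [integral_add' (hsq m) ((hcentred.const_inner (m - a)).const_mul 2), integral_const_mul,
    hcross] at hint
  linarith

lemma integral_norm_clip_sub_integral_sq_le {d : ℕ} {X : Ξ → Vec d} {lam α s : ℝ} (m : Vec d)
    (hX : AEStronglyMeasurable X D) (hlam : 0 < lam) (hα : 0 ≤ α) (hα2 : α ≤ 2)
    (hY : Integrable (fun ξ => ‖X ξ - m‖ ^ α) D) (hs : ∫ ξ, ‖X ξ - m‖ ^ α ∂D ≤ s) :
    ∫ ξ, ‖clip (X ξ) lam - ∫ η, clip (X η) lam ∂D‖ ^ 2 ∂D ≤ 4 * lam ^ (2 - α) * s := by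
  have hpt (ξ : Ξ) :
      ‖clip (X ξ) lam - clip m lam‖ ^ 2 ≤ 4 * lam ^ (2 - α) * ‖X ξ - m‖ ^ α := by
    have hbdd : ‖clip (X ξ) lam - clip m lam‖ ≤ 2 * lam :=
      (norm_sub_le _ _).trans (by linarith [norm_clip_le hlam (X ξ), norm_clip_le hlam m])
    have htwo : (2 : ℝ) ^ (2 - α) ≤ 4 :=
      (Real.rpow_le_rpow_of_exponent_le one_le_two (by linarith : 2 - α ≤ 2)).trans
        (by norm_num)
    calc ‖clip (X ξ) lam - clip m lam‖ ^ 2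
        = ‖clip (X ξ) lam - clip m lam‖ ^ (2 - α) * ‖clip (X ξ) lam - clip m lam‖ ^ α := by
          rw [← Real.rpow_add_of_nonneg (norm_nonneg _) (by linarith) hα]; norm_num
      _ ≤ (2 * lam) ^ (2 - α) * ‖X ξ - m‖ ^ α := by
          gcongr
          exact norm_clip_sub_clip_le hlam _ _
      _ ≤ 4 * lam ^ (2 - α) * ‖X ξ - m‖ ^ α := by
          rw [Real.mul_rpow zero_le_two hlam.le]
          gcongr
  have hclip : AEStronglyMeasurable (fun ξ => clip (X ξ) lam) D := (integrable_clip hX hlam).1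
  calc _ ≤ ∫ ξ, ‖clip (X ξ) lam - clip m lam‖ ^ 2 ∂D :=
        integral_norm_sub_integral_sq_le
          (.of_bound hclip lam (.of_forall fun ξ => norm_clip_le hlam _)) _
    _ ≤ ∫ ξ, 4 * lam ^ (2 - α) * ‖X ξ - m‖ ^ α ∂D :=
        integral_mono_of_nonneg (.of_forall fun ξ => by positivity) (hY.const_mul _)
          (.of_forall hpt)
    _ = 4 * lam ^ (2 - α) * ∫ ξ, ‖X ξ - m‖ ^ α ∂D := integral_const_mul _ _
    _ ≤ _ := by gcongr

lemma lintegral_exp_inner_add_norm_sq_le {θ : Ξ → E} {M V p q : ℝ} (hθ : AEStronglyMeasurable θ D)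
    (hM : ∀ ξ, ‖θ ξ‖ ≤ M) (hmean : ∫ ξ, θ ξ ∂D = 0) (hV : ∫ ξ, ‖θ ξ‖ ^ 2 ∂D ≤ V)
    (u : E) (hp : 0 ≤ p) (hq : 0 ≤ q) (hpq : p * ‖u‖ * M + q * M ^ 2 ≤ 1) :
    ∫⁻ ξ, ENNReal.ofReal (Real.exp (-p * inner ℝ u (θ ξ) + q * ‖θ ξ‖ ^ 2)) ∂D
      ≤ ENNReal.ofReal (Real.exp ((2 * p ^ 2 * ‖u‖ ^ 2 + 3 * q) * V)) := by
  set b := 2 * p ^ 2 * ‖u‖ ^ 2 + 3 * q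
  have hpt (ξ : Ξ) := exp_inner_add_norm_sq_le (hM ξ) hp hq hpq
  have hLp : MemLp θ 2 D := .of_bound hθ M (.of_forall hM)
  have hlin : Integrable (fun ξ => 1 + -p * inner ℝ u (θ ξ)) D :=
    (integrable_const 1).add (((hLp.integrable one_le_two).const_inner u).const_mul (-p))
  have hsq : Integrable (fun ξ => b * ‖θ ξ‖ ^ 2) D :=
    (hLp.integrable_norm_pow two_ne_zero).const_mul b
  have hmean_lin : ∫ ξ, (1 + -p * inner ℝ u (θ ξ)) ∂D = 1 := by
    rw [integral_add (integrable_const 1)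
        (((hLp.integrable one_le_two).const_inner u).const_mul (-p)), integral_const_mul,
      integral_inner (hLp.integrable one_le_two), hmean]
    simp
  calc _ ≤ ∫⁻ ξ, ENNReal.ofReal (1 + -p * inner ℝ u (θ ξ) + b * ‖θ ξ‖ ^ 2) ∂D :=
        lintegral_mono fun ξ => ENNReal.ofReal_le_ofReal (hpt ξ)
    _ = ENNReal.ofReal (∫ ξ, (1 + -p * inner ℝ u (θ ξ) + b * ‖θ ξ‖ ^ 2) ∂D) :=
        (ofReal_integral_eq_lintegral_ofReal (hlin.add hsq)
          (.of_forall fun ξ => (Real.exp_pos _).le.trans (hpt ξ))).symm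
    _ ≤ ENNReal.ofReal (b * V + 1) := by
        rw [integral_add hlin hsq, hmean_lin, integral_const_mul, add_comm]
        gcongr
    _ ≤ _ := by gcongr; exact Real.add_one_le_exp _

end Moments

section Gaussian

lemma gaussianPDFReal_mul_exp_add_sq {a t : ℝ} (ht : t < 1 / 2) (x : ℝ) :
    gaussianPDFReal 0 1 x * Real.exp (a * x + t * x ^ 2)
      = (√(2 * Real.pi))⁻¹ * Real.exp (a ^ 2 / (2 * (1 - 2 * t)))
        * Real.exp (-(1 / 2 - t) * (x - a / (1 - 2 * t)) ^ 2) := by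
  have ht' : 1 - 2 * t ≠ 0 := by linarith
  simp only [gaussianPDFReal, NNReal.coe_one, mul_one, sub_zero]
  rw [mul_assoc, mul_assoc, ← Real.exp_add, ← Real.exp_add]
  congr 2
  field_simp
  ring

lemma integrable_exp_mul_add_mul_sq_gaussianReal {a t : ℝ} (ht : t < 1 / 2) :
    Integrable (fun x : ℝ => Real.exp (a * x + t * x ^ 2)) (gaussianReal 0 1) := by
  rw [gaussianReal_of_var_ne_zero 0 one_ne_zero,
    integrable_withDensity_iff_integrable_smul' (measurable_gaussianPDF 0 1)
      (.of_forall fun x => gaussianPDF_lt_top)]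
  simp only [toReal_gaussianPDF, smul_eq_mul, gaussianPDFReal_mul_exp_add_sq ht]
  exact ((integrable_exp_neg_mul_sq (by linarith : 0 < 1 / 2 - t)).comp_sub_right _).const_mul _

lemma integral_exp_mul_add_mul_sq_gaussianReal {a t : ℝ} (ht : t < 1 / 2) :
    ∫ x, Real.exp (a * x + t * x ^ 2) ∂(gaussianReal 0 1)
      = (√(1 - 2 * t))⁻¹ * Real.exp (a ^ 2 / (2 * (1 - 2 * t))) := by
  have : 0 < 1 / 2 - t := by linarith
  have hsqrt : (√(2 * Real.pi))⁻¹ * √(Real.pi / (1 / 2 - t)) = (√(1 - 2 * t))⁻¹ := by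
    rw [← Real.sqrt_inv, ← Real.sqrt_inv, ← Real.sqrt_mul (by positivity)]
    congr 1
    have := Real.pi_pos
    have : 1 - 2 * t ≠ 0 := by linarith
    field_simp
  rw [integral_gaussianReal_eq_integral_smul one_ne_zero]
  simp only [smul_eq_mul, gaussianPDFReal_mul_exp_add_sq ht]
  rw [integral_const_mul,
    integral_sub_right_eq_self (fun x : ℝ => Real.exp (-(1 / 2 - t) * x ^ 2)), integral_gaussian,
    ← hsqrt]
  ring

lemma inv_sqrt_one_sub_le_exp {x : ℝ} (hx0 : 0 ≤ x) (hx : x ≤ 1 / 2) :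
    (√(1 - x))⁻¹ ≤ Real.exp x := by
  have hexp : 1 ≤ (1 - x) * Real.exp (2 * x) :=
    calc 1 ≤ (1 - x) * (2 * x + 1) := by nlinarith
      _ ≤ (1 - x) * Real.exp (2 * x) := by
        gcongr
        exacts [by linarith, Real.add_one_le_exp _]
  rw [← Real.sqrt_inv]
  apply Real.sqrt_le_iff.2 ⟨(Real.exp_pos x).le, ?_⟩
  rwa [← Real.exp_nat_mul, inv_le_iff_one_le_mul₀' (by linarith), Nat.cast_two]

lemma integral_exp_mul_add_mul_sq_gaussianReal_le {a t : ℝ} (ht0 : 0 ≤ t) (ht : t ≤ 1 / 4) :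
    ∫ x, Real.exp (a * x + t * x ^ 2) ∂(gaussianReal 0 1) ≤ Real.exp (a ^ 2 + 2 * t) := by
  rw [integral_exp_mul_add_mul_sq_gaussianReal (by linarith), add_comm, Real.exp_add]
  have hle : a ^ 2 / (2 * (1 - 2 * t)) ≤ a ^ 2 :=
    div_le_self (sq_nonneg a) (by linarith)
  gcongr
  exact inv_sqrt_one_sub_le_exp (by linarith) (by linarith)

lemma gaussianNoise_eq_map_stdGaussian (d : ℕ) (s : ℝ) :
    gaussianNoise d s = (stdGaussian (Vec d)).map (fun x => s • x) := by
  have : IsProbabilityMeasure ((stdGaussian (Vec d)).map (fun x => s • x)) :=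
    Measure.isProbabilityMeasure_map (by fun_prop)
  rw [gaussianNoise]
  apply Measure.ext_of_charFun
  ext t
  have hdot : t.ofLp ⬝ᵥ t.ofLp = ‖t‖ ^ 2 := by
    rw [EuclideanSpace.real_norm_sq_eq]; simp [dotProduct, sq]
  rw [charFun_multivariateGaussian (Matrix.PosSemidef.one.smul (sq_nonneg s)),
    charFun_map_smul, charFun_stdGaussian]
  have hsq : ‖s • t‖ ^ 2 = s ^ 2 * ‖t‖ ^ 2 := by rw [norm_smul, mul_pow, Real.norm_eq_abs, sq_abs]
  simp only [inner_zero_right, Complex.ofReal_zero, zero_mul, zero_sub, Matrix.smul_mulVec,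
    Matrix.one_mulVec, dotProduct_smul, hdot, smul_eq_mul, ← Complex.ofReal_pow, hsq]
  congr 1
  ring

lemma lintegral_exp_inner_add_norm_sq_stdGaussian_le {d : ℕ} {q : ℝ} (hq : 0 ≤ q)
    (hq4 : q ≤ 1 / 4) (u : Vec d) :
    ∫⁻ w, ENNReal.ofReal (Real.exp (inner ℝ u w + q * ‖w‖ ^ 2)) ∂(stdGaussian (Vec d))
      ≤ ENNReal.ofReal (Real.exp (‖u‖ ^ 2 + 2 * d * q)) := by
  have hprod (x : Fin d → ℝ) :
      Real.exp (inner ℝ u (WithLp.toLp 2 x) + q * ‖WithLp.toLp 2 x‖ ^ 2)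
        = ∏ i, Real.exp (u i * x i + q * x i ^ 2) := by
    rw [← Real.exp_sum, EuclideanSpace.real_norm_sq_eq, Finset.sum_add_distrib, ← Finset.mul_sum,
      PiLp.inner_apply]
    simp [mul_comm]
  rw [← map_pi_eq_stdGaussian, lintegral_map (by fun_prop) (by fun_prop)]
  simp only [hprod]
  rw [← ofReal_integral_eq_lintegral_ofReal
    (Integrable.fintype_prod fun i =>
      integrable_exp_mul_add_mul_sq_gaussianReal (a := u i) (by linarith))
    (.of_forall fun x => by positivity), integral_fintype_prod_eq_prod
      (f := fun i y => Real.exp (u i * y + q * y ^ 2))]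
  apply ENNReal.ofReal_le_ofReal
  calc _ ≤ ∏ i : Fin d, Real.exp (u i ^ 2 + 2 * q) :=
        Finset.prod_le_prod (fun i _ => integral_nonneg fun x => by positivity)
          fun i _ => integral_exp_mul_add_mul_sq_gaussianReal_le hq hq4
    _ = _ := by
        rw [← Real.exp_sum, Finset.sum_add_distrib, EuclideanSpace.real_norm_sq_eq,
          Finset.sum_const, Finset.card_univ, Fintype.card_fin, nsmul_eq_mul]
        congr 1
        ring

lemma lintegral_exp_inner_add_norm_sq_gaussianNoise_le {d : ℕ} {s p q : ℝ} (hq : 0 ≤ q)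
    (hqs : q * s ^ 2 ≤ 1 / 4) (u : Vec d) :
    ∫⁻ w, ENNReal.ofReal (Real.exp (-p * inner ℝ u w + q * ‖w‖ ^ 2)) ∂(gaussianNoise d s)
      ≤ ENNReal.ofReal (Real.exp ((p ^ 2 * ‖u‖ ^ 2 + 2 * d * q) * s ^ 2)) := by
  have hscale (w : Vec d) : -p * inner ℝ u (s • w) + q * ‖s • w‖ ^ 2
      = inner ℝ ((-p * s) • u) w + q * s ^ 2 * ‖w‖ ^ 2 := by
    rw [inner_smul_right, real_inner_smul_left, norm_smul, mul_pow, Real.norm_eq_abs, sq_abs]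
    ring
  rw [gaussianNoise_eq_map_stdGaussian, lintegral_map (by fun_prop) (by fun_prop)]
  simp only [hscale]
  refine (lintegral_exp_inner_add_norm_sq_stdGaussian_le (by positivity) hqs _).trans_eq ?_
  rw [norm_smul, mul_pow, Real.norm_eq_abs, sq_abs]
  ring_nf

end Gaussian

section Recursion

variable {Ω E T : Type*}

/-- The trajectory from `t₀` of the recursion `t_{k+1} = step (t_k, y_k)` driven by the inputs
`y`. -/
def orbit (step : T × E → T) (t₀ : T) (y : ℕ → E) : ℕ → T
  | 0 => t₀
  | k + 1 => step (orbit step t₀ y k, y k)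

variable [MeasurableSpace E] [MeasurableSpace T] {step : T × E → T}

lemma measurable_orbit [MeasurableSpace Ω] {Y : ℕ → Ω → E} (hstep : Measurable step) (t₀ : T)
    {k : ℕ} (hY : ∀ j < k, Measurable (Y j)) :
    Measurable fun ω => orbit step t₀ (fun j => Y j ω) k := by
  induction k with
  | zero => exact measurable_const
  | succ k ih =>
    exact hstep.comp ((ih fun j hj => hY j (hj.trans k.lt_succ_self)).prodMk (hY k k.lt_succ_self))

/-- The σ-algebra generated by the inputs `Y 0, …, Y (k - 1)`. -/
abbrev pastSigma (Y : ℕ → Ω → E) (k : ℕ) : MeasurableSpace Ω :=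
  ⨆ j ∈ Set.Iio k, MeasurableSpace.comap (Y j) inferInstance

lemma measurable_pastSigma (Y : ℕ → Ω → E) {j k : ℕ} (hjk : j < k) :
    Measurable[pastSigma Y k] (Y j) :=
  (comap_measurable (Y j)).mono
    (le_biSup (fun i => MeasurableSpace.comap (Y i) inferInstance) (Set.mem_Iio.2 hjk)) le_rfl

variable [MeasurableSpace Ω] {P : Measure Ω} {Y : ℕ → Ω → E}

lemma indepFun_of_measurable_pastSigma {F : Type*} [MeasurableSpace F] (hind : iIndepFun Y P)
    (hY : ∀ k, Measurable (Y k)) {k : ℕ} {H : Ω → F} (hH : Measurable[pastSigma Y k] H) :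
    IndepFun H (Y k) P := by
  have hindep : Indep (pastSigma Y k)
      (⨆ i ∈ ({k} : Set ℕ), MeasurableSpace.comap (Y i) inferInstance) P :=
    indep_iSup_of_disjoint (fun i => (hY i).comap_le) hind (by simp)
  rw [IndepFun_iff_Indep]
  refine indep_of_indep_of_le_left (indep_of_indep_of_le_right hindep ?_) hH.comap_le
  exact le_biSup (fun i => MeasurableSpace.comap (Y i) inferInstance) (Set.mem_singleton k)

lemma lintegral_mul_le_of_indepFun [IsFiniteMeasure P] {H : Ω → T} {G : Ω → ENNReal} {y : Ω → E}
    (hH : Measurable H) (hG : Measurable G) (hy : Measurable y)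
    (hind : IndepFun (fun ω => (H ω, G ω)) y P) {h : T × E → ENNReal} (hh : Measurable h)
    {B : ENNReal} (hB : ∀ t, ∫⁻ e, h (t, e) ∂(P.map y) ≤ B) :
    ∫⁻ ω, G ω * h (H ω, y ω) ∂P ≤ (∫⁻ ω, G ω ∂P) * B := by
  have hF : Measurable fun z : (T × ENNReal) × E => z.1.2 * h (z.1.1, z.2) :=
    Measurable.mul (by fun_prop) (hh.comp (by fun_prop))
  have hHG := hH.prodMk hG
  calc ∫⁻ ω, G ω * h (H ω, y ω) ∂P
      = ∫⁻ z, z.1.2 * h (z.1.1, z.2) ∂(P.map fun ω => ((H ω, G ω), y ω)) :=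
        (lintegral_map hF (hHG.prodMk hy)).symm
    _ = ∫⁻ ω, ∫⁻ e, G ω * h (H ω, e) ∂(P.map y) ∂P := by
        rw [(indepFun_iff_map_prod_eq_prod_map_map hHG.aemeasurable hy.aemeasurable).1 hind,
          lintegral_prod _ hF.aemeasurable, lintegral_map hF.lintegral_prod_right' hHG]
    _ ≤ ∫⁻ ω, G ω * B ∂P := by
        refine lintegral_mono fun ω => ?_
        rw [lintegral_const_mul (f := fun e => h (H ω, e)) _ (by fun_prop)]
        gcongr
        exact hB _
    _ = (∫⁻ ω, G ω ∂P) * B := lintegral_mul_const _ hG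

lemma measure_add_le_le_of_lintegral_exp_le {f : Ω → ℝ} {b : ℝ} (hf : AEMeasurable f P)
    (hb : ∫⁻ ω, ENNReal.ofReal (Real.exp (f ω)) ∂P ≤ ENNReal.ofReal (Real.exp b)) (r : ℝ) :
    P {ω | b + r ≤ f ω} ≤ ENNReal.ofReal (Real.exp (-r)) :=
  calc _ ≤ P {ω | ENNReal.ofReal (Real.exp (b + r)) ≤ ENNReal.ofReal (Real.exp (f ω))} :=
        measure_mono fun _ hω => ENNReal.ofReal_le_ofReal (Real.exp_le_exp.2 hω)
    _ ≤ (∫⁻ ω, ENNReal.ofReal (Real.exp (f ω)) ∂P) / ENNReal.ofReal (Real.exp (b + r)) :=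
        meas_ge_le_lintegral_div (by fun_prop) (by simp [Real.exp_pos]) ENNReal.ofReal_ne_top
    _ ≤ ENNReal.ofReal (Real.exp b) / ENNReal.ofReal (Real.exp (b + r)) := by gcongr
    _ = ENNReal.ofReal (Real.exp (-r)) := by
        rw [← ENNReal.ofReal_div_of_pos (Real.exp_pos _), ← Real.exp_sub]
        congr 2
        ring

variable [IsProbabilityMeasure P] {ν : Measure E}

lemma lintegral_prod_orbit_le (hY : ∀ k, Measurable (Y k)) (hlaw : ∀ k, P.map (Y k) = ν)
    (hind : iIndepFun Y P) (hstep : Measurable step) (t₀ : T) {h : T × E → ENNReal}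
    (hh : Measurable h) {B : ENNReal} (hB : ∀ t, ∫⁻ y, h (t, y) ∂ν ≤ B) (k : ℕ) :
    ∫⁻ ω, ∏ j ∈ Finset.range k, h (orbit step t₀ (fun i => Y i ω) j, Y j ω) ∂P ≤ B ^ k := by
  induction k with
  | zero => simp
  | succ k ih =>
    have hpast {j : ℕ} (hj : j ≤ k) :
        Measurable[pastSigma Y k] fun ω => orbit step t₀ (fun i => Y i ω) j :=
      @measurable_orbit _ _ _ _ _ _ (pastSigma Y k) _ hstep t₀ _ fun i hi =>
        measurable_pastSigma Y (hi.trans_le hj)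
    have hprod : Measurable[pastSigma Y k] fun ω =>
        ∏ j ∈ Finset.range k, h (orbit step t₀ (fun i => Y i ω) j, Y j ω) := by
      refine Finset.measurable_fun_prod _ fun j hj => ?_
      have hjk := Finset.mem_range.1 hj
      exact hh.comp ((hpast hjk.le).prodMk (measurable_pastSigma Y hjk))
    have hle : pastSigma Y k ≤ ‹MeasurableSpace Ω› := iSup₂_le fun j _ => (hY j).comap_le
    simp only [Finset.prod_range_succ]
    calc _ ≤ (∫⁻ ω, ∏ j ∈ Finset.range k, h (orbit step t₀ (fun i => Y i ω) j, Y j ω) ∂P) * B :=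
          lintegral_mul_le_of_indepFun ((hpast le_rfl).mono hle le_rfl) (hprod.mono hle le_rfl)
            (hY k) (indepFun_of_measurable_pastSigma hind hY ((hpast le_rfl).prodMk hprod)) hh
            (by rwa [hlaw])
      _ ≤ B ^ (k + 1) := by rw [pow_succ]; gcongr

lemma measure_sum_orbit_ge_le (hY : ∀ k, Measurable (Y k)) (hlaw : ∀ k, P.map (Y k) = ν)
    (hind : iIndepFun Y P) (hstep : Measurable step) (t₀ : T) {Z : T × E → ℝ} (hZ : Measurable Z)
    {a : ℝ} (hB : ∀ t, ∫⁻ y, ENNReal.ofReal (Real.exp (Z (t, y))) ∂ν ≤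
      ENNReal.ofReal (Real.exp a)) (k : ℕ) (r : ℝ) :
    P {ω | k * a + r ≤ ∑ j ∈ Finset.range k, Z (orbit step t₀ (fun i => Y i ω) j, Y j ω)}
      ≤ ENNReal.ofReal (Real.exp (-r)) := by
  have hsum : Measurable fun ω =>
      ∑ j ∈ Finset.range k, Z (orbit step t₀ (fun i => Y i ω) j, Y j ω) :=
    Finset.measurable_fun_sum _ fun j _ =>
      hZ.comp ((measurable_orbit hstep t₀ fun i _ => hY i).prodMk (hY j))
  refine measure_add_le_le_of_lintegral_exp_le hsum.aemeasurable ?_ r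
  have hexp_sum (ω : Ω) : ENNReal.ofReal (Real.exp
      (∑ j ∈ Finset.range k, Z (orbit step t₀ (fun i => Y i ω) j, Y j ω))) =
        ∏ j ∈ Finset.range k,
          ENNReal.ofReal (Real.exp (Z (orbit step t₀ (fun i => Y i ω) j, Y j ω))) := by
    rw [Real.exp_sum, ENNReal.ofReal_prod_of_nonneg fun _ _ => (Real.exp_pos _).le]
  simp only [hexp_sum]
  rw [Real.exp_nat_mul, ENNReal.ofReal_pow (Real.exp_pos _).le]
  exact lintegral_prod_orbit_le hY hlaw hind hstep t₀
    (h := fun z => ENNReal.ofReal (Real.exp (Z z))) (by fun_prop) hB k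

/-- Chernoff's bound for each `k`, and a union bound over `k`. -/
lemma measure_exists_sum_orbit_ge_le (hY : ∀ k, Measurable (Y k)) (hlaw : ∀ k, P.map (Y k) = ν)
    (hind : iIndepFun Y P) (hstep : Measurable step) (t₀ : T) {Z : T × E → ℝ} (hZ : Measurable Z)
    {a : ℝ} (ha : 0 ≤ a) (hB : ∀ t, ∫⁻ y, ENNReal.ofReal (Real.exp (Z (t, y))) ∂ν ≤
      ENNReal.ofReal (Real.exp a)) (K : ℕ) (r : ℝ) :
    P {ω | ∃ k ∈ Finset.Icc 1 K,
        K * a + r ≤ ∑ j ∈ Finset.range k, Z (orbit step t₀ (fun i => Y i ω) j, Y j ω)}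
      ≤ ENNReal.ofReal (K * Real.exp (-r)) := by
  calc _ ≤ P (⋃ k ∈ Finset.Icc 1 K, {ω |
          k * a + r ≤ ∑ j ∈ Finset.range k, Z (orbit step t₀ (fun i => Y i ω) j, Y j ω)}) := by
        refine measure_mono fun ω => ?_
        rintro ⟨k, hk, hω⟩
        have hkK : (k : ℝ) ≤ K := by exact_mod_cast (Finset.mem_Icc.1 hk).2
        refine Set.mem_biUnion hk (le_trans ?_ hω)
        gcongr
    _ ≤ ∑ k ∈ Finset.Icc 1 K, P {ω |
          k * a + r ≤ ∑ j ∈ Finset.range k, Z (orbit step t₀ (fun i => Y i ω) j, Y j ω)} :=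
        measure_biUnion_finset_le _ _
    _ ≤ ∑ _k ∈ Finset.Icc 1 K, ENNReal.ofReal (Real.exp (-r)) :=
        Finset.sum_le_sum fun k _ => measure_sum_orbit_ge_le hY hlaw hind hstep t₀ hZ hB k r
    _ = _ := by
        rw [Finset.sum_const, Nat.card_Icc, Nat.add_sub_cancel, nsmul_eq_mul,
          ENNReal.ofReal_mul (Nat.cast_nonneg K), ENNReal.ofReal_natCast]

end Recursion

section Descent

variable {d : ℕ} {f : Vec d → ℝ} {xs x : Vec d} {L r : ℝ}

/-- The deterministic assumptions on the objective: on the ball of radius `r` around `xs`, the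
function `f` is minimized by `xs`, is `L`-smooth and is convex. -/
structure IsSmoothConvexNear (f : Vec d → ℝ) (xs : Vec d) (L r : ℝ) : Prop where
  isMinOn : IsMinOn f (Metric.closedBall xs r) xs
  smoothOn : SmoothOn f L (Metric.closedBall xs r)
  firstOrderConvexOn : FirstOrderConvexOn f (Metric.closedBall xs r)

namespace IsSmoothConvexNear

lemma gradient_eq_zero (hf : IsSmoothConvexNear f xs L r) (hr : 0 < r) : ∇ f xs = 0 := by
  have hlocal : IsLocalMin f xs := hf.isMinOn.isLocalMin (Metric.closedBall_mem_nhds xs hr)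
  simp [gradient, hlocal.fderiv_eq_zero]

lemma norm_gradient_le (hf : IsSmoothConvexNear f xs L r) (hr : 0 < r)
    (hx : x ∈ Metric.closedBall xs r) : ‖∇ f x‖ ≤ L * ‖x - xs‖ := by
  have hLip := hf.smoothOn.2 x hx xs (Metric.mem_closedBall_self hr.le)
  rwa [hf.gradient_eq_zero hr, sub_zero] at hLip

lemma gap_nonneg (hf : IsSmoothConvexNear f xs L r) (hx : x ∈ Metric.closedBall xs r) :
    0 ≤ f x - f xs :=
  sub_nonneg.2 (hf.isMinOn hx)

lemma gap_le_inner (hf : IsSmoothConvexNear f xs L r) (hx : x ∈ Metric.closedBall xs r) :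
    f x - f xs ≤ inner ℝ (x - xs) (∇ f x) := by
  have hr : 0 ≤ r := dist_nonneg.trans (Metric.mem_closedBall.1 hx)
  have hconv := hf.firstOrderConvexOn x hx xs (Metric.mem_closedBall_self hr)
  rw [real_inner_comm, ← neg_sub x xs, inner_neg_left] at hconv
  linarith

lemma gap_le (hf : IsSmoothConvexNear f xs L r) (hr : 0 < r) (hx : x ∈ Metric.closedBall xs r) :
    f x - f xs ≤ L * ‖x - xs‖ ^ 2 :=
  calc f x - f xs ≤ inner ℝ (x - xs) (∇ f x) := hf.gap_le_inner hx
    _ ≤ ‖x - xs‖ * ‖∇ f x‖ := real_inner_le_norm _ _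
    _ ≤ ‖x - xs‖ * (L * ‖x - xs‖) := by gcongr; exact hf.norm_gradient_le hr hx
    _ = L * ‖x - xs‖ ^ 2 := by ring

lemma gradient_step_mem (hf : IsSmoothConvexNear f xs L r) (hr : 0 < r)
    (hx : x ∈ Metric.closedBall xs r) {η : ℝ} (hη : 0 ≤ η)
    (hηx : (1 + (η * L) ^ 2) * ‖x - xs‖ ^ 2 ≤ r ^ 2) : x - η • ∇ f x ∈ Metric.closedBall xs r := by
  have hinner : 0 ≤ inner ℝ (x - xs) (∇ f x) := (hf.gap_nonneg hx).trans (hf.gap_le_inner hx)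
  have hgrad : (η * ‖∇ f x‖) ^ 2 ≤ (η * (L * ‖x - xs‖)) ^ 2 := by
    gcongr
    exact hf.norm_gradient_le hr hx
  rw [mem_closedBall_iff_norm, sub_right_comm]
  apply le_of_sq_le_sq _ hr.le
  rw [norm_sub_sq_real, inner_smul_right, norm_smul, Real.norm_of_nonneg hη]
  nlinarith [mul_nonneg hη hinner]

/-- A gradient step of length `1 / (2 L)` stays in the ball and decreases `f` by at least
`‖∇ f x‖ ^ 2 / (4 L)`. -/
lemma norm_gradient_sq_le (hf : IsSmoothConvexNear f xs L r) (hL : 0 < L) (hr : 0 < r)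
    (hx : 5 * ‖x - xs‖ ^ 2 ≤ 4 * r ^ 2) : ‖∇ f x‖ ^ 2 ≤ 4 * L * (f x - f xs) := by
  have hxm : x ∈ Metric.closedBall xs r := by
    rw [mem_closedBall_iff_norm]
    exact le_of_sq_le_sq (by nlinarith [sq_nonneg ‖x - xs‖]) hr.le
  set g := ∇ f x
  set η := 1 / (2 * L) with hη
  have hη0 : 0 < η := by positivity
  have hηL : η * L = 1 / 2 := by rw [hη]; field_simp
  have hym : x - η • g ∈ Metric.closedBall xs r :=
    hf.gradient_step_mem hr hxm hη0.le (by rw [hηL]; linarith)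
  have hconv := hf.firstOrderConvexOn _ hym x hxm
  have hgap := hf.gap_nonneg hym
  have hLip : ‖∇ f (x - η • g) - g‖ ≤ 1 / 2 * ‖g‖ :=
    calc _ ≤ L * ‖x - η • g - x‖ := hf.smoothOn.2 _ hym x hxm
      _ = η * L * ‖g‖ := by
        rw [sub_sub_cancel_left, norm_neg, norm_smul, Real.norm_of_nonneg hη0.le]; ring
      _ = 1 / 2 * ‖g‖ := by rw [hηL]
  have hinner : 1 / 2 * ‖g‖ ^ 2 ≤ inner ℝ (∇ f (x - η • g)) g :=
    calc 1 / 2 * ‖g‖ ^ 2 = ‖g‖ ^ 2 - 1 / 2 * ‖g‖ * ‖g‖ := by ring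
      _ ≤ ‖g‖ ^ 2 - ‖∇ f (x - η • g) - g‖ * ‖g‖ := by gcongr
      _ ≤ ‖g‖ ^ 2 + inner ℝ (∇ f (x - η • g) - g) g := by
        linarith [(abs_le.1 (abs_real_inner_le_norm (∇ f (x - η • g) - g) g)).1]
      _ = inner ℝ (∇ f (x - η • g)) g := by
        rw [inner_sub_left, real_inner_self_eq_norm_sq]; ring
  rw [sub_sub_cancel, inner_smul_right] at hconv
  have hdecrease : η * (1 / 2 * ‖g‖ ^ 2) ≤ f x - f xs := by
    linarith [mul_le_mul_of_nonneg_left hinner hη0.le]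
  calc ‖g‖ ^ 2 = 4 * L * (η * (1 / 2 * ‖g‖ ^ 2)) := by linear_combination (-2 * ‖g‖ ^ 2) * hηL
    _ ≤ 4 * L * (f x - f xs) := by gcongr

end IsSmoothConvexNear

section StepContribution

variable {E : Type*} [NormedAddCommGroup E] [InnerProductSpace ℝ E]

/-- The share of a summand `v` of the update direction in the change of the squared distance
to `0` when a step of size `γ` is taken from `u`. The constant `4` accounts for directions with
up to four summands. -/
def stepContribution (γ : ℝ) (u v : E) : ℝ :=
  -(2 * γ) * inner ℝ u v + 4 * γ ^ 2 * ‖v‖ ^ 2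

lemma norm_sub_smul_add₄_sq_le (γ : ℝ) (u a b c e : E) :
    ‖u - γ • (a + b + c + e)‖ ^ 2 ≤ ‖u‖ ^ 2 + (stepContribution γ u a + stepContribution γ u b
      + stepContribution γ u c + stepContribution γ u e) := by
  have hsum : ‖a + b + c + e‖ ^ 2 ≤ 4 * (‖a‖ ^ 2 + ‖b‖ ^ 2 + ‖c‖ ^ 2 + ‖e‖ ^ 2) := by
    calc _ ≤ (‖a‖ + ‖b‖ + ‖c‖ + ‖e‖) ^ 2 := by gcongr; exact norm_add₄_le
      _ ≤ _ := by
        linarith [sq_nonneg (‖a‖ - ‖b‖), sq_nonneg (‖a‖ - ‖c‖), sq_nonneg (‖a‖ - ‖e‖),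
          sq_nonneg (‖b‖ - ‖c‖), sq_nonneg (‖b‖ - ‖e‖), sq_nonneg (‖c‖ - ‖e‖)]
  simp only [stepContribution]
  rw [norm_sub_sq_real, norm_smul, mul_pow, Real.norm_eq_abs, sq_abs, inner_smul_right,
    inner_add_right, inner_add_right, inner_add_right]
  linarith [mul_le_mul_of_nonneg_left hsum (sq_nonneg γ)]

lemma stepContribution_le {γ ρ b : ℝ} {u v : E} (hγ : 0 ≤ γ) (hu : ‖u‖ ≤ ρ) (hv : ‖v‖ ≤ b) :
    stepContribution γ u v ≤ 2 * ρ * (γ * b) + 4 * (γ * b) ^ 2 := by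
  have hinner : -(ρ * b) ≤ inner ℝ u v :=
    calc -(ρ * b) ≤ -(‖u‖ * ‖v‖) := by
          have : 0 ≤ ρ := (norm_nonneg u).trans hu
          gcongr
      _ ≤ inner ℝ u v := (abs_le.1 (abs_real_inner_le_norm u v)).1
  have hsq : ‖v‖ ^ 2 ≤ b ^ 2 := by gcongr
  rw [stepContribution]
  linarith [mul_le_mul_of_nonneg_left hinner hγ, mul_le_mul_of_nonneg_left hsq (sq_nonneg γ)]

end StepContribution

lemma IsSmoothConvexNear.stepContribution_gradient_le (hf : IsSmoothConvexNear f xs L r)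
    (hL : 0 < L) (hr : 0 < r) (hx : 5 * ‖x - xs‖ ^ 2 ≤ 4 * r ^ 2) {γ : ℝ} (hγ : 0 ≤ γ)
    (hγL : γ * L ≤ 1 / 16) : stepContribution γ (x - xs) (∇ f x) ≤ -(γ * (f x - f xs)) := by
  have hxm : x ∈ Metric.closedBall xs r := by
    rw [mem_closedBall_iff_norm]
    exact le_of_sq_le_sq (by nlinarith [sq_nonneg ‖x - xs‖]) hr.le
  have hgap := hf.gap_nonneg hxm
  have hlin : γ * (f x - f xs) ≤ γ * inner ℝ (x - xs) (∇ f x) := by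
    gcongr
    exact hf.gap_le_inner hxm
  have hquad : 4 * γ ^ 2 * ‖∇ f x‖ ^ 2 ≤ γ * (f x - f xs) :=
    calc 4 * γ ^ 2 * ‖∇ f x‖ ^ 2 ≤ 4 * γ ^ 2 * (4 * L * (f x - f xs)) := by
          gcongr
          exact hf.norm_gradient_sq_le hL hr hx
      _ = 16 * (γ * L) * (γ * (f x - f xs)) := by ring
      _ ≤ γ * (f x - f xs) := mul_le_of_le_one_left (by positivity) (by linarith)
  rw [stepContribution]
  linarith

/-- Telescoping for a sequence `D` that only obeys the one-step bound as long as it stays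
below `ρ`. -/
lemma sum_le_of_telescope_of_le {D g n : ℕ → ℝ} {ρ : ℝ} {K : ℕ} (hD : ∀ k, 0 ≤ D k)
    (hg : ∀ k, D k ≤ ρ → 0 ≤ g k) (hstep : ∀ k, D k ≤ ρ → D (k + 1) + g k ≤ D k + n k)
    (hn : ∀ k ≤ K, (∀ j < k, D j ≤ ρ) → D 0 + ∑ j ∈ Finset.range k, n j ≤ ρ) :
    ∑ j ∈ Finset.range K, g j ≤ ρ := by
  have htelescope : ∀ k, (∀ j < k, D j ≤ ρ) →
      D k + ∑ j ∈ Finset.range k, g j ≤ D 0 + ∑ j ∈ Finset.range k, n j := by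
    intro k hk
    induction k with
    | zero => simp
    | succ k ih =>
      have hprev := ih fun j hj => hk j (hj.trans k.lt_succ_self)
      have hlast := hstep k (hk k k.lt_succ_self)
      rw [Finset.sum_range_succ, Finset.sum_range_succ]
      linarith
  have hsum_nonneg : ∀ k, (∀ j < k, D j ≤ ρ) → 0 ≤ ∑ j ∈ Finset.range k, g j := fun k hk =>
    Finset.sum_nonneg fun j hj => hg j (hk j (Finset.mem_range.1 hj))
  have htrapped : ∀ k < K, D k ≤ ρ := by
    intro k
    induction k using Nat.strong_induction_on with
    | _ k ih =>
      intro hkK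
      have hpast : ∀ j < k, D j ≤ ρ := fun j hj => ih j hj (hj.trans hkK)
      linarith [htelescope k hpast, hsum_nonneg k hpast, hn k hkK.le hpast]
  linarith [htelescope K htrapped, hn K le_rfl htrapped, hD K]

/-- One step of the method, whose direction is split into the mean `G` of the clipped stochastic
gradient, its fluctuation `θ` and the privacy noise `w`. -/
lemma IsSmoothConvexNear.norm_step_sq_add_gap_le {R γ b : ℝ}
    (hf : IsSmoothConvexNear f xs L (2 * R)) (hL : 0 < L) (hR : 0 < R)
    (hx : ‖x - xs‖ ≤ 3 / 2 * R) (hγ : 0 ≤ γ) (hγL : γ * L ≤ 1 / 16) {G : Vec d}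
    (hG : ‖G - ∇ f x‖ ≤ b) (θ w : Vec d) :
    ‖x - γ • (G + θ + w) - xs‖ ^ 2 + γ * (f x - f xs) ≤ ‖x - xs‖ ^ 2
      + (stepContribution γ (x - xs) θ + stepContribution γ (x - xs) w
        + (3 * R * (γ * b) + 4 * (γ * b) ^ 2)) := by
  have hdecomp : x - γ • (G + θ + w) - xs
      = (x - xs) - γ • (∇ f x + (G - ∇ f x) + θ + w) := by module
  have hx2 : ‖x - xs‖ ^ 2 ≤ (3 / 2 * R) ^ 2 := by gcongr
  have hgrad := hf.stepContribution_gradient_le hL (by linarith) (by nlinarith) hγ hγL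
  have hbias := stepContribution_le hγ hx hG
  rw [hdecomp]
  linarith [norm_sub_smul_add₄_sq_le γ (x - xs) (∇ f x) (G - ∇ f x) θ w]

lemma IsSmoothConvexNear.sum_gap_le {X G θ w : ℕ → Vec d} {R γ b : ℝ} {K : ℕ}
    (hf : IsSmoothConvexNear f xs L (2 * R)) (hL : 0 < L) (hR : 0 < R) (hX0 : ‖X 0 - xs‖ ≤ R)
    (hX : ∀ k, X (k + 1) = X k - γ • (G k + θ k + w k)) (hγ : 0 ≤ γ) (hγL : γ * L ≤ 1 / 16)
    (hG : ∀ k, ‖X k - xs‖ ≤ 3 / 2 * R → ‖G k - ∇ f (X k)‖ ≤ b) (hb : 0 ≤ b)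
    (hKb : K * (3 * R * (γ * b) + 4 * (γ * b) ^ 2) ≤ R ^ 2 / 2)
    (hnoise : ∀ k ≤ K, (∀ j < k, ‖X j - xs‖ ≤ 3 / 2 * R) →
      ∑ j ∈ Finset.range k,
        (stepContribution γ (X j - xs) (θ j) + stepContribution γ (X j - xs) (w j)) ≤ R ^ 2 / 2) :
    ∑ j ∈ Finset.range K, γ * (f (X j) - f xs) ≤ (3 / 2 * R) ^ 2 := by
  have hball (k : ℕ) : ‖X k - xs‖ ^ 2 ≤ (3 / 2 * R) ^ 2 ↔ ‖X k - xs‖ ≤ 3 / 2 * R :=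
    sq_le_sq₀ (norm_nonneg _) (by positivity)
  refine sum_le_of_telescope_of_le (D := fun k => ‖X k - xs‖ ^ 2)
    (n := fun k => stepContribution γ (X k - xs) (θ k) + stepContribution γ (X k - xs) (w k)
        + (3 * R * (γ * b) + 4 * (γ * b) ^ 2))
    (fun k => sq_nonneg _) (fun k hk => ?_) (fun k hk => ?_) (fun k hk hpast => ?_)
  · exact mul_nonneg hγ (hf.gap_nonneg (mem_closedBall_iff_norm.2
      (((hball k).1 hk).trans (by linarith))))
  · simp only [hX]
    exact hf.norm_step_sq_add_gap_le hL hR ((hball k).1 hk) hγ hγL (hG k ((hball k).1 hk)) _ _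
  · have hstart : ‖X 0 - xs‖ ^ 2 ≤ R ^ 2 := by gcongr
    have hbias : k * (3 * R * (γ * b) + 4 * (γ * b) ^ 2) ≤ R ^ 2 / 2 :=
      le_trans (by gcongr) hKb
    rw [Finset.sum_add_distrib, Finset.sum_const, Finset.card_range, nsmul_eq_mul]
    linarith [hnoise k hk fun j hj => (hball j).1 (hpast j hj), sq_nonneg R]

lemma bestValue_sub_le_div (f : Vec d → ℝ) (X : ℕ → Vec d) {K : ℕ} (hK : 1 ≤ K) {m B : ℝ}
    (hB : ∑ j ∈ Finset.range K, (f (X j) - m) ≤ B) : bestValue f X K - m ≤ B / K := by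
  have hbest : ∑ _j ∈ Finset.range K, (bestValue f X K - m)
      ≤ ∑ j ∈ Finset.range K, (f (X j) - m) := by
    refine Finset.sum_le_sum fun j hj => sub_le_sub_right ?_ m
    exact Finset.inf'_le _ (Finset.mem_range.2 ((Finset.mem_range.1 hj).trans K.lt_succ_self))
  rw [Finset.sum_const, Finset.card_range, nsmul_eq_mul] at hbest
  rw [le_div_iff₀' (by exact_mod_cast hK)]
  exact hbest.trans hB

end Descent

section NoiseMoment

instance (d : ℕ) (s : ℝ) : IsProbabilityMeasure (gaussianNoise d s) := by
  unfold gaussianNoise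
  infer_instance

lemma lintegral_exp_add_prod_le {X Y : Type*} [MeasurableSpace X] [MeasurableSpace Y]
    {μ : Measure X} {ν : Measure Y} [SFinite ν] {f : X → ℝ} {g : Y → ℝ} {a b : ℝ}
    (hf : AEMeasurable f μ) (hg : AEMeasurable g ν)
    (ha : ∫⁻ x, ENNReal.ofReal (Real.exp (f x)) ∂μ ≤ ENNReal.ofReal (Real.exp a))
    (hb : ∫⁻ y, ENNReal.ofReal (Real.exp (g y)) ∂ν ≤ ENNReal.ofReal (Real.exp b)) :
    ∫⁻ z, ENNReal.ofReal (Real.exp (f z.1 + g z.2)) ∂(μ.prod ν)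
      ≤ ENNReal.ofReal (Real.exp (a + b)) := by
  simp only [Real.exp_add, ENNReal.ofReal_mul (Real.exp_pos _).le]
  rw [lintegral_prod_mul (f := fun x => ENNReal.ofReal (Real.exp (f x)))
    (g := fun y => ENNReal.ofReal (Real.exp (g y))) (by fun_prop) (by fun_prop)]
  exact mul_le_mul' ha hb

variable {R γ l V : ℝ} {K : ℕ}

/-- Both noises of one step enter the Chernoff bound with the parameter `4 l / R ^ 2`; this is
the common estimate of their log-moments, with `n = 1` for the clipped gradient and `n = d` for
the Gaussian noise. -/
lemma logMoment_le {n ρ : ℝ} (hR : 0 < R) (hl : 1 ≤ l) (hK : 1 ≤ K) (hn : 1 ≤ n) (hV : 0 ≤ V)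
    (hρ : 0 ≤ ρ) (hρR : ρ ≤ 3 / 2 * R) (hγV : 672 * (γ ^ 2 * (n * V)) * (K * l) ≤ R ^ 2) :
    (2 * (2 * (4 * l / R ^ 2) * γ) ^ 2 * ρ ^ 2 + 3 * n * (4 * (4 * l / R ^ 2) * γ ^ 2)) * V
      ≤ l / (2 * K) := by
  have : (0 : ℝ) < K := by exact_mod_cast hK
  have hlinear : 2 * (2 * (4 * l / R ^ 2)) ^ 2 * ρ ^ 2 ≤ 288 * (n * (l ^ 2 / R ^ 2)) :=
    calc _ ≤ 2 * (2 * (4 * l / R ^ 2)) ^ 2 * (3 / 2 * R) ^ 2 := by gcongr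
      _ = 288 * (1 * (l ^ 2 / R ^ 2)) := by field_simp; norm_num
      _ ≤ _ := by gcongr
  have hquadratic : 3 * n * (4 * (4 * l / R ^ 2)) ≤ 48 * (n * (l ^ 2 / R ^ 2)) :=
    calc _ = 48 * (n * (l * 1 / R ^ 2)) := by ring
      _ ≤ 48 * (n * (l * l / R ^ 2)) := by gcongr
      _ = _ := by ring
  calc _ = (2 * (2 * (4 * l / R ^ 2)) ^ 2 * ρ ^ 2 + 3 * n * (4 * (4 * l / R ^ 2)))
        * (γ ^ 2 * V) := by ring
    _ ≤ 336 * (n * (l ^ 2 / R ^ 2)) * (γ ^ 2 * V) := by gcongr; linarith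
    _ = l / (2 * K * R ^ 2) * (672 * (γ ^ 2 * (n * V)) * (K * l)) := by field_simp; ring
    _ ≤ l / (2 * K * R ^ 2) * R ^ 2 := by gcongr
    _ = l / (2 * K) := by field_simp

variable {d : ℕ} {u : Vec d}

lemma mul_stepContribution (s γ : ℝ) (u v : Vec d) :
    s * stepContribution γ u v = -(2 * s * γ) * inner ℝ u v + 4 * s * γ ^ 2 * ‖v‖ ^ 2 := by
  rw [stepContribution]
  ring

variable {Ξ : Type*} [MeasurableSpace Ξ] {D : Measure Ξ} [IsProbabilityMeasure D] {θ : Ξ → Vec d}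
  {M : ℝ}

lemma lintegral_exp_stepContribution_le (hθ : AEStronglyMeasurable θ D) (hM : ∀ ξ, ‖θ ξ‖ ≤ M)
    (hmean : ∫ ξ, θ ξ ∂D = 0) (hV : ∫ ξ, ‖θ ξ‖ ^ 2 ∂D ≤ V) (hK : 1 ≤ K) (hR : 0 < R)
    (hγ : 0 ≤ γ) (hl : 1 ≤ l) (hu : ‖u‖ ≤ 3 / 2 * R)
    (hγV : 672 * (γ ^ 2 * V) * (K * l) ≤ R ^ 2) (hγM : γ * M * l ≤ R / 50) :
    ∫⁻ ξ, ENNReal.ofReal (Real.exp (4 * l / R ^ 2 * stepContribution γ u (θ ξ))) ∂D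
      ≤ ENNReal.ofReal (Real.exp (l / (2 * K))) := by
  have hV0 : 0 ≤ V := le_trans (integral_nonneg fun ξ => sq_nonneg _) hV
  have hM0 : 0 ≤ M := by
    obtain ⟨ξ⟩ := nonempty_of_isProbabilityMeasure D
    exact (norm_nonneg _).trans (hM ξ)
  have hγM0 : 0 ≤ γ * M := by positivity
  have hγM1 : γ * M ≤ R / 50 := (le_mul_of_one_le_right hγM0 hl).trans hγM
  have hpq : 2 * (4 * l / R ^ 2) * γ * ‖u‖ * M + 4 * (4 * l / R ^ 2) * γ ^ 2 * M ^ 2 ≤ 1 :=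
    calc _ = 8 / R ^ 2 * (γ * M * l) * (‖u‖ + 2 * (γ * M)) := by ring
      _ ≤ 8 / R ^ 2 * (R / 50) * (3 / 2 * R + 2 * (R / 50)) := by gcongr
      _ = 8 / 50 * (3 / 2 + 1 / 25) := by field_simp; norm_num
      _ ≤ 1 := by norm_num
  simp only [mul_stepContribution]
  refine (lintegral_exp_inner_add_norm_sq_le hθ hM hmean hV u (by positivity) (by positivity)
    hpq).trans (ENNReal.ofReal_le_ofReal (Real.exp_le_exp.2 ?_))
  simpa only [mul_one] using logMoment_le (ρ := ‖u‖) hR hl hK le_rfl hV0 (norm_nonneg u) hu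
    (by rwa [one_mul])

lemma lintegral_exp_stepContribution_gaussianNoise_le {σω : ℝ} (hd : 1 ≤ d) (hK : 1 ≤ K)
    (hR : 0 < R) (hl : 1 ≤ l) (hu : ‖u‖ ≤ 3 / 2 * R)
    (hγσ : 672 * (γ ^ 2 * (d * σω ^ 2)) * (K * l) ≤ R ^ 2) :
    ∫⁻ w, ENNReal.ofReal (Real.exp (4 * l / R ^ 2 * stepContribution γ u w)) ∂(gaussianNoise d σω)
      ≤ ENNReal.ofReal (Real.exp (l / (2 * K))) := by
  have hd1 : (1 : ℝ) ≤ d := by exact_mod_cast hd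
  have hK1 : (1 : ℝ) ≤ K := by exact_mod_cast hK
  have hqs : 4 * (4 * l / R ^ 2) * γ ^ 2 * σω ^ 2 ≤ 1 / 4 :=
    calc _ = 16 / R ^ 2 * ((γ ^ 2 * (1 * σω ^ 2)) * (1 * l)) := by ring
      _ ≤ 16 / R ^ 2 * ((γ ^ 2 * (d * σω ^ 2)) * (K * l)) := by gcongr
      _ = 1 / 42 / R ^ 2 * (672 * (γ ^ 2 * (d * σω ^ 2)) * (K * l)) := by ring
      _ ≤ 1 / 42 / R ^ 2 * R ^ 2 := by gcongr
      _ = 1 / 42 := by field_simp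
      _ ≤ 1 / 4 := by norm_num
  simp only [mul_stepContribution]
  refine (lintegral_exp_inner_add_norm_sq_gaussianNoise_le (by positivity) hqs u).trans
    (ENNReal.ofReal_le_ofReal (Real.exp_le_exp.2 (le_trans ?_
      (logMoment_le hR hl hK hd1 (sq_nonneg σω) (norm_nonneg u) hu hγσ))))
  have hslack : 0 ≤ (2 * (4 * l / R ^ 2) * γ) ^ 2 * ‖u‖ ^ 2 := by positivity
  have hslack' : 0 ≤ d * (4 * (4 * l / R ^ 2) * γ ^ 2) := by positivity
  gcongr ?_ * _
  linarith

end NoiseMoment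

section StepSize

variable {d K : ℕ} {L R σ α lam β σω c l γ : ℝ}

lemma zeta_nonneg : 0 ≤ zeta L R lam := le_max_left _ _

lemma rpow_le_effNoise : σ ^ α ≤ effNoise L R σ α lam :=
  le_add_of_nonneg_right (Real.rpow_nonneg zeta_nonneg α)

lemma effNoise_pos (hσ : 0 < σ) : 0 < effNoise L R σ α lam :=
  (Real.rpow_pos_of_pos hσ α).trans_le rpow_le_effNoise

lemma biasFactor_pos (hL : 0 < L) (hR : 0 < R) (hσ : 0 < σ) (hlam : 0 < lam) :
    0 < biasFactor L R σ α lam := by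
  have hζ : 0 ≤ zeta L R lam := zeta_nonneg
  have hS : 0 < effNoise L R σ α lam := effNoise_pos hσ
  unfold biasFactor
  positivity

/-- The quantity `S B / lam ^ (α - 1)`, the order of the bias that clipping introduces into the
stochastic gradient. -/
noncomputable def clipBias (L R σ α lam : ℝ) : ℝ :=
  effNoise L R σ α lam * biasFactor L R σ α lam / lam ^ (α - 1)

lemma clipBias_pos (hL : 0 < L) (hR : 0 < R) (hσ : 0 < σ) (hlam : 0 < lam) :
    0 < clipBias L R σ α lam :=
  div_pos (mul_pos (effNoise_pos hσ) (biasFactor_pos hL hR hσ hlam)) (Real.rpow_pos_of_pos hlam _)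

lemma rpow_le_mul_mul_rpow {S : ℝ} (hσ : 0 < σ) (hα : 1 ≤ α) (hS : σ ^ α ≤ S) :
    σ ^ α ≤ S * (σ * S ^ (-1 / α)) := by
  have hS0 : 0 < S := (Real.rpow_pos_of_pos hσ α).trans_le hS
  have hα0 : 0 < α := by linarith
  have hpow : σ ^ (α - 1) ≤ S ^ ((α - 1) / α) :=
    calc σ ^ (α - 1) = (σ ^ α) ^ ((α - 1) / α) := by
          rw [← Real.rpow_mul hσ.le, mul_div_cancel₀ _ hα0.ne']
      _ ≤ S ^ ((α - 1) / α) := by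
          have : 0 ≤ (α - 1) / α := div_nonneg (by linarith) hα0.le
          gcongr
  calc σ ^ α = σ * σ ^ (α - 1) := by rw [Real.rpow_sub_one hσ.ne']; field_simp
    _ ≤ σ * S ^ ((α - 1) / α) := by gcongr
    _ = σ * S ^ (1 + -1 / α) := by congr 2; field_simp; ring
    _ = S * (σ * S ^ (-1 / α)) := by rw [Real.rpow_add hS0, Real.rpow_one]; ring

lemma zeta_add_le_two_mul_clipBias (hL : 0 < L) (hR : 0 < R) (hσ : 0 < σ) (hα : 1 ≤ α)
    (hlam : 0 < lam) :
    zeta L R lam + 2 * lam ^ (1 - α) * σ ^ α ≤ 2 * clipBias L R σ α lam := by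
  have hζ : 0 ≤ zeta L R lam := zeta_nonneg
  have hS : 0 < effNoise L R σ α lam := effNoise_pos hσ
  have hσS := rpow_le_mul_mul_rpow hσ hα (rpow_le_effNoise (L := L) (R := R) (lam := lam))
  rw [clipBias, biasFactor]
  set S := effNoise L R σ α lam
  set ζ := zeta L R lam
  have hexpand :
      S * (L * R / lam + lam ^ (α - 1) * ζ / S + σ * S ^ (-1 / α)) / lam ^ (α - 1)
        = S * (L * R / lam) / lam ^ (α - 1) + ζ + S * (σ * S ^ (-1 / α)) / lam ^ (α - 1) := by
    field_simp
  have hfirst : 0 ≤ S * (L * R / lam) / lam ^ (α - 1) := by positivity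
  have hthird : lam ^ (1 - α) * σ ^ α ≤ S * (σ * S ^ (-1 / α)) / lam ^ (α - 1) := by
    rw [← neg_sub α 1, Real.rpow_neg hlam.le, inv_mul_eq_div]
    gcongr
  rw [hexpand]
  linarith

section Bounds

lemma stepSizeMin_pos (hL : 0 < L) (hR : 0 < R) (hσ : 0 < σ) (hlam : 0 < lam) (hd : 1 ≤ d)
    (hK : 1 ≤ K) (hl : 0 < Real.log (K / β)) (hσω : 0 < σω) :
    0 < stepSizeMin d K L R σ α lam β σω := by
  have hB : 0 < biasFactor L R σ α lam := biasFactor_pos hL hR hσ hlam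
  have hS : 0 < effNoise L R σ α lam := effNoise_pos hσ
  have : (0 : ℝ) < K := by exact_mod_cast hK
  have : (0 : ℝ) < d := by exact_mod_cast hd
  unfold stepSizeMin
  refine lt_min (lt_min ?_ ?_) (lt_min ?_ ?_) <;> positivity

variable (hγ : γ ≤ c * stepSizeMin d K L R σ α lam β σω)
include hγ

lemma mul_smoothness_le (hc : 0 ≤ c) (hL : 0 < L) : γ * L ≤ c := by
  have hmin : stepSizeMin d K L R σ α lam β σω ≤ 1 / L :=
    (min_le_left _ _).trans (min_le_left _ _)
  rw [← le_div_iff₀ hL, ← mul_one_div]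
  exact hγ.trans (by gcongr)

lemma sq_mul_variance_le (hc : 0 ≤ c) (hγ0 : 0 ≤ γ) (hK : 1 ≤ K) (hσ : 0 < σ) (hlam : 0 < lam)
    (hl : 0 < Real.log (K / β)) :
    γ ^ 2 * (lam ^ (2 - α) * effNoise L R σ α lam) * (K * Real.log (K / β)) ≤ (c * R) ^ 2 := by
  have hS : 0 < effNoise L R σ α lam := effNoise_pos hσ
  have : (0 : ℝ) < K := by exact_mod_cast hK
  have hmin : stepSizeMin d K L R σ α lam β σω
      ≤ R / (lam ^ (1 - α / 2) * √(K * Real.log (K / β) * effNoise L R σ α lam)) :=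
    (min_le_left _ _).trans (min_le_right _ _)
  have hlin : γ * (lam ^ (1 - α / 2) * √(K * Real.log (K / β) * effNoise L R σ α lam))
      ≤ c * R := by
    rw [← le_div_iff₀ (by positivity), mul_div_assoc]
    exact hγ.trans (by gcongr)
  have hpow : lam ^ (2 - α) = (lam ^ (1 - α / 2)) ^ 2 := by
    rw [← Real.rpow_natCast, ← Real.rpow_mul hlam.le]
    congr 1
    push_cast
    ring
  calc _ = (γ * (lam ^ (1 - α / 2) * √(K * Real.log (K / β) * effNoise L R σ α lam))) ^ 2 := by
        rw [mul_pow, mul_pow, Real.sq_sqrt (by positivity), hpow]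
        ring
    _ ≤ (c * R) ^ 2 := by gcongr

lemma mul_clipBias_le (hc : 0 ≤ c) (hK : 1 ≤ K) (hL : 0 < L) (hR : 0 < R) (hσ : 0 < σ)
    (hlam : 0 < lam) : K * (γ * clipBias L R σ α lam) ≤ c * R := by
  have hB : 0 < biasFactor L R σ α lam := biasFactor_pos hL hR hσ hlam
  have hS : 0 < effNoise L R σ α lam := effNoise_pos hσ
  have : (0 : ℝ) < K := by exact_mod_cast hK
  have hmin : stepSizeMin d K L R σ α lam β σω
      ≤ R * lam ^ (α - 1) / (K * effNoise L R σ α lam * biasFactor L R σ α lam) :=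
    (min_le_right _ _).trans (min_le_left _ _)
  calc K * (γ * clipBias L R σ α lam)
      ≤ K * (c * (R * lam ^ (α - 1) / (K * effNoise L R σ α lam * biasFactor L R σ α lam))
        * clipBias L R σ α lam) := by
        have := clipBias_pos (α := α) hL hR hσ hlam
        gcongr
        exact hγ.trans (by gcongr)
    _ = c * R := by rw [clipBias]; field_simp

lemma sq_mul_gaussianVariance_le (hc : 0 ≤ c) (hγ0 : 0 ≤ γ) (hd : 1 ≤ d) (hK : 1 ≤ K)
    (hσω : 0 < σω) (hl : 0 < Real.log (K / β)) :
    γ ^ 2 * (d * σω ^ 2) * (K * Real.log (K / β)) ≤ (c * R) ^ 2 := by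
  have : (0 : ℝ) < K := by exact_mod_cast hK
  have : (0 : ℝ) < d := by exact_mod_cast hd
  have hmin : stepSizeMin d K L R σ α lam β σω ≤ R / (σω * √(d * K * Real.log (K / β))) :=
    (min_le_right _ _).trans (min_le_right _ _)
  have hlin : γ * (σω * √(d * K * Real.log (K / β))) ≤ c * R := by
    rw [← le_div_iff₀ (by positivity), mul_div_assoc]
    exact hγ.trans (by gcongr)
  calc _ = (γ * (σω * √(d * K * Real.log (K / β)))) ^ 2 := by
        rw [mul_pow, mul_pow, Real.sq_sqrt (by positivity)]
        ring
    _ ≤ (c * R) ^ 2 := by gcongr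

end Bounds

/-- The admissible clipping levels turn the variance bound on `γ` into a bound on the size
`γ * lam` of a clipped step. -/
lemma mul_mul_log_le {A S : ℝ} (hA : 0 ≤ A) (hα : 0 ≤ α) (hα2 : α ≤ 2) (hlam : 0 < lam)
    (hl : 0 ≤ l) (hc : 0 ≤ c) (hR : 0 ≤ R) (hlamA : lam ^ α * l ≤ A ^ α * K * S)
    (hγ : γ ^ 2 * (lam ^ (2 - α) * S) * (K * l) ≤ (c * R) ^ 2) :
    γ * lam * l ≤ c * max 1 A * R := by
  have hlam2 : lam ^ (2 - α) * lam ^ α = lam ^ 2 := by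
    rw [← Real.rpow_add hlam, sub_add_cancel, Real.rpow_two]
  have hAα : A ^ α ≤ max 1 A ^ 2 :=
    calc A ^ α ≤ max 1 A ^ α := by gcongr; exact le_max_right _ _
      _ ≤ max 1 A ^ (2 : ℝ) := Real.rpow_le_rpow_of_exponent_le (le_max_left _ _) hα2
      _ = max 1 A ^ 2 := Real.rpow_two _
  refine le_of_sq_le_sq ?_ (by positivity)
  calc (γ * lam * l) ^ 2 = γ ^ 2 * lam ^ (2 - α) * l * (lam ^ α * l) := by
        rw [mul_pow, mul_pow, ← hlam2]
        ring
    _ ≤ γ ^ 2 * lam ^ (2 - α) * l * (A ^ α * K * S) := by gcongr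
    _ = γ ^ 2 * (lam ^ (2 - α) * S) * (K * l) * A ^ α := by ring
    _ ≤ (c * R) ^ 2 * max 1 A ^ 2 := by gcongr
    _ = (c * max 1 A * R) ^ 2 := by ring

/-- The smallness conditions on the step-size `γ` under which `K` steps stay in the ball of
radius `3 / 2 * R` up to an event of probability `K * exp (-l)`. -/
structure IsSmallStep (d K : ℕ) (L R σ α lam σω l γ : ℝ) : Prop where
  pos : 0 < γ
  mul_smoothness_le : γ * L ≤ 1 / 16
  sq_mul_variance_le :
    672 * (γ ^ 2 * (4 * lam ^ (2 - α) * effNoise L R σ α lam)) * (K * l) ≤ R ^ 2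
  mul_clipLevel_le : γ * (2 * lam) * l ≤ R / 50
  mul_clipBias_le : K * (γ * (2 * clipBias L R σ α lam)) ≤ R / 50
  sq_mul_gaussianVariance_le : 672 * (γ ^ 2 * (d * σω ^ 2)) * (K * l) ≤ R ^ 2

lemma IsSmallStep.mul_bias_cost_le (hγ : IsSmallStep d K L R σ α lam σω l γ) (hL : 0 < L)
    (hR : 0 < R) (hσ : 0 < σ) (hlam : 0 < lam) (hK : 1 ≤ K) :
    K * (3 * R * (γ * (2 * clipBias L R σ α lam)) + 4 * (γ * (2 * clipBias L R σ α lam)) ^ 2)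
      ≤ R ^ 2 / 2 := by
  have hK1 : (1 : ℝ) ≤ K := by exact_mod_cast hK
  have hKb := hγ.mul_clipBias_le
  have hb0 : 0 ≤ γ * (2 * clipBias L R σ α lam) :=
    mul_nonneg hγ.pos.le (mul_nonneg two_pos.le (clipBias_pos hL hR hσ hlam).le)
  set b := γ * (2 * clipBias L R σ α lam)
  have hb : b ≤ R / 50 := (le_mul_of_one_le_left hb0 hK1).trans hKb
  calc K * (3 * R * b + 4 * b ^ 2) = K * b * (3 * R + 4 * b) := by ring
    _ ≤ R / 50 * (3 * R + 4 * (R / 50)) := by gcongr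
    _ ≤ R ^ 2 / 2 := by nlinarith

lemma isSmallStep_of_le {A : ℝ} (hL : 0 < L) (hR : 0 < R) (hσ : 0 < σ) (hα : 0 ≤ α)
    (hα2 : α ≤ 2) (hlam : 0 < lam) (hd : 1 ≤ d) (hK : 1 ≤ K) (hl : 0 < Real.log (K / β))
    (hσω : 0 < σω) (hA : 0 ≤ A) (hc : 0 ≤ c) (hcA : c * max 1 A ≤ 1 / 100)
    (hlamA : lam ^ α * Real.log (K / β) ≤ A ^ α * K * effNoise L R σ α lam) (hγ0 : 0 < γ)
    (hγ : γ ≤ c * stepSizeMin d K L R σ α lam β σω) :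
    IsSmallStep d K L R σ α lam σω (Real.log (K / β)) γ := by
  have hc1 : c ≤ 1 / 100 := (le_mul_of_one_le_right hc (le_max_left _ _)).trans hcA
  have hcR : c * R ≤ 1 / 100 * R := by gcongr
  have hcR2 : (c * R) ^ 2 ≤ (1 / 100 * R) ^ 2 := by gcongr
  have hcAR : c * max 1 A * R ≤ 1 / 100 * R := by gcongr
  have hvar := sq_mul_variance_le hγ hc hγ0.le hK hσ hlam hl
  exact {
    pos := hγ0
    mul_smoothness_le := (mul_smoothness_le hγ hc hL).trans (by linarith)
    sq_mul_variance_le := by nlinarith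
    mul_clipLevel_le := by linarith [mul_mul_log_le hA hα hα2 hlam hl.le hc hR.le hlamA hvar]
    mul_clipBias_le := by linarith [mul_clipBias_le hγ hc hK hL hR hσ hlam]
    sq_mul_gaussianVariance_le := by
      nlinarith [sq_mul_gaussianVariance_le hγ hc hγ0.le hd hK hσω hl] }

end StepSize

section Rate

variable {d K : ℕ} {L R σ α lam β σω ε δ a : ℝ}

lemma sq_div_mul_le_detTerm (hL : 0 < L) : R ^ 2 / (1 / L * K) ≤ detTerm K L R lam := by
  calc _ = L * R ^ 2 / K := by field_simp
    _ ≤ detTerm K L R lam := by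
        rw [detTerm]
        exact le_add_of_nonneg_right (by positivity)

lemma sq_div_mul_le_stochTerm (hL : 0 < L) (hR : 0 < R) (hσ : 0 < σ) (hlam : 0 < lam)
    (hK : 1 ≤ K) (hl : 0 < Real.log (K / β)) :
    R ^ 2 / (R / (lam ^ (1 - α / 2) * √(K * Real.log (K / β) * effNoise L R σ α lam)) * K)
      ≤ stochTerm K L R σ α lam β := by
  have hS : 0 < effNoise L R σ α lam := effNoise_pos hσ
  have hK0 : (0 : ℝ) < K := by exact_mod_cast hK
  have hsqrt : √(K * Real.log (K / β) * effNoise L R σ α lam) / K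
      = √(effNoise L R σ α lam * Real.log (K / β) / K) := by
    calc _ = √(K * Real.log (K / β) * effNoise L R σ α lam) / √((K : ℝ) ^ 2) := by
          rw [Real.sqrt_sq hK0.le]
      _ = √(K * Real.log (K / β) * effNoise L R σ α lam / (K : ℝ) ^ 2) :=
          (Real.sqrt_div' _ (sq_nonneg _)).symm
      _ = _ := by congr 1; field_simp
  calc _ = R * lam ^ (1 - α / 2) * (√(K * Real.log (K / β) * effNoise L R σ α lam) / K) := by
        field_simp
    _ ≤ stochTerm K L R σ α lam β := by
        rw [hsqrt, stochTerm]
        exact le_add_of_nonneg_right (by positivity)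

lemma sq_div_mul_le_biasTerm (hL : 0 < L) (hR : 0 < R) (hσ : 0 < σ) (hlam : 0 < lam)
    (hK : 1 ≤ K) :
    R ^ 2 / (R * lam ^ (α - 1) / (K * effNoise L R σ α lam * biasFactor L R σ α lam) * K)
      ≤ biasTerm L R σ α lam := by
  have hB : 0 < biasFactor L R σ α lam := biasFactor_pos hL hR hσ hlam
  have hS : 0 < effNoise L R σ α lam := effNoise_pos hσ
  have : (0 : ℝ) < K := by exact_mod_cast hK
  calc _ = R * effNoise L R σ α lam * biasFactor L R σ α lam / lam ^ (α - 1) := by field_simp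
    _ ≤ biasTerm L R σ α lam := le_add_of_nonneg_right (by positivity)

lemma log_natCast_div_pos (hK : 1 ≤ K) (hδ : 0 < δ) (hδ1 : δ < 1) : 0 < Real.log (K / δ) := by
  have hK1 : (1 : ℝ) ≤ K := by exact_mod_cast hK
  exact Real.log_pos ((one_lt_div hδ).2 (hδ1.trans_le hK1))

lemma dpScale_pos (hK : 1 ≤ K) (hlam : 0 < lam) (hε : 0 < ε) (hδ : 0 < δ) (hδ1 : δ < 1) :
    0 < dpScale K lam ε δ := by
  have : (0 : ℝ) < K := by exact_mod_cast hK
  have hlogK := log_natCast_div_pos hK hδ hδ1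
  have hlog : 0 < Real.log (1 / δ) := by simpa using log_natCast_div_pos le_rfl hδ hδ1
  unfold dpScale
  positivity

lemma sq_div_mul_le_dpTerm (hL : 0 < L) (hR : 0 < R) (hd : 1 ≤ d) (hK : 1 ≤ K)
    (hl : 0 < Real.log (K / β)) (hσω : 0 < σω) (hε : 0 < ε) (hδ : 0 < δ) (hδ1 : δ < 1)
    (ha : 0 ≤ a) (hup : σω ≤ a * dpScale K lam ε δ) :
    R ^ 2 / (R / (σω * √(d * K * Real.log (K / β))) * K) ≤ a * dpTerm d K L R lam β ε δ := by
  have hK0 : (0 : ℝ) < K := by exact_mod_cast hK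
  have : (0 : ℝ) < d := by exact_mod_cast hd
  have hlogK := log_natCast_div_pos hK hδ hδ1
  have hlog : 0 < Real.log (1 / δ) := by simpa using log_natCast_div_pos le_rfl hδ hδ1
  have hsqrt : √(K * Real.log (K / δ) * Real.log (1 / δ)) * √(d * K * Real.log (K / β))
      = √(d * Real.log (K / β) * Real.log (K / δ) * Real.log (1 / δ)) * K := by
    have hdpos : 0 ≤ d * Real.log (K / β) * Real.log (K / δ) * Real.log (1 / δ) := by positivity
    calc _ = √(d * Real.log (K / β) * Real.log (K / δ) * Real.log (1 / δ) * (K : ℝ) ^ 2) := by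
          rw [← Real.sqrt_mul (by positivity)]; ring_nf
      _ = _ := by rw [Real.sqrt_mul hdpos, Real.sqrt_sq hK0.le]
  calc _ = R * σω * √(d * K * Real.log (K / β)) / K := by field_simp
    _ ≤ R * (a * dpScale K lam ε δ) * √(d * K * Real.log (K / β)) / K := by gcongr
    _ = a * (R * lam / ε * (√(K * Real.log (K / δ) * Real.log (1 / δ))
          * √(d * K * Real.log (K / β)) / K)) := by rw [dpScale]; ring
    _ = a * (R * lam / ε * √(d * Real.log (K / β) * Real.log (K / δ) * Real.log (1 / δ))) := by
        rw [hsqrt, mul_div_cancel_right₀ _ hK0.ne']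
    _ ≤ a * dpTerm d K L R lam β ε δ := by
        rw [dpTerm]
        gcongr
        exact le_add_of_nonneg_right (by positivity)

/-- The right-hand side `max {T₁, T₂, T₃, T₄}` of the convergence guarantee. -/
noncomputable def errorBound (d K : ℕ) (L R σ α lam β ε δ : ℝ) : ℝ :=
  max (max (detTerm K L R lam) (stochTerm K L R σ α lam β))
    (max (biasTerm L R σ α lam) (dpTerm d K L R lam β ε δ))

lemma detTerm_le_errorBound : detTerm K L R lam ≤ errorBound d K L R σ α lam β ε δ :=
  (le_max_left _ _).trans (le_max_left _ _)

lemma errorBound_nonneg (hL : 0 < L) : 0 ≤ errorBound d K L R σ α lam β ε δ := by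
  refine le_trans ?_ detTerm_le_errorBound
  unfold detTerm
  positivity

lemma div_min_mul_le {r k p q M : ℝ} (hp : r / (p * k) ≤ M) (hq : r / (q * k) ≤ M) :
    r / (min p q * k) ≤ M := by
  rcases min_choice p q with h | h <;> rwa [h]

lemma sq_div_stepSizeMin_mul_le (hL : 0 < L) (hR : 0 < R) (hσ : 0 < σ) (hlam : 0 < lam)
    (hd : 1 ≤ d) (hK : 1 ≤ K) (hl : 0 < Real.log (K / β)) (hσω : 0 < σω) (hε : 0 < ε)
    (hδ : 0 < δ) (hδ1 : δ < 1) (ha : 0 ≤ a) (hup : σω ≤ a * dpScale K lam ε δ) :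
    R ^ 2 / (stepSizeMin d K L R σ α lam β σω * K)
      ≤ (1 + a) * errorBound d K L R σ α lam β ε δ := by
  set E := errorBound d K L R σ α lam β ε δ
  have hE0 : 0 ≤ E := errorBound_nonneg hL
  have hone : E ≤ (1 + a) * E := le_mul_of_one_le_left hE0 (by linarith)
  have hdet : detTerm K L R lam ≤ E := detTerm_le_errorBound
  have hstoch : stochTerm K L R σ α lam β ≤ E := (le_max_right _ _).trans (le_max_left _ _)
  have hbias : biasTerm L R σ α lam ≤ E := (le_max_left _ _).trans (le_max_right _ _)
  have hdp : a * dpTerm d K L R lam β ε δ ≤ (1 + a) * E :=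
    calc _ ≤ a * E := by gcongr; exact (le_max_right _ _).trans (le_max_right _ _)
      _ ≤ (1 + a) * E := by gcongr; linarith
  exact div_min_mul_le
    (div_min_mul_le ((sq_div_mul_le_detTerm hL).trans (hdet.trans hone))
      ((sq_div_mul_le_stochTerm hL hR hσ hlam hK hl).trans (hstoch.trans hone)))
    (div_min_mul_le ((sq_div_mul_le_biasTerm hL hR hσ hlam hK).trans (hbias.trans hone))
      ((sq_div_mul_le_dpTerm hL hR hd hK hl hσω hε hδ hδ1 ha hup).trans hdp))

end Rate

section HighProbability

variable {d K : ℕ} {Ξ : Type*} {g : Ξ → Vec d → Vec d} {f : Vec d → ℝ} {x xs x₀ : Vec d}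
  {L R σ α lam σω l γ : ℝ}

/-- One step of DP-Clipped-SGD with the stochastic gradient `g`, as a function of the current
point and of the pair of a sample and a noise vector. -/
noncomputable def clippedStep (g : Ξ → Vec d → Vec d) (γ lam : ℝ) (z : Vec d × (Ξ × Vec d)) :
    Vec d :=
  z.1 - γ • (clip (g z.2.1 z.1) lam + z.2.2)

lemma iterate_eq_orbit (ℓ : Ξ → Vec d → ℝ) (γ lam : ℝ) (x₀ : Vec d) (ξ : ℕ → Ξ)
    (w : ℕ → Vec d) : iterate ℓ γ lam x₀ ξ w
      = orbit (clippedStep (fun ξ x => ∇ (ℓ ξ) x) γ lam) x₀ fun k => (ξ k, w k) := by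
  funext k
  induction k with
  | zero => rfl
  | succ k ih => rw [iterate, orbit, ih, clippedStep]

variable [MeasurableSpace Ξ] {D : Measure Ξ}

/-- `g` is a stochastic gradient of `f`: on `Q` it is unbiased and its central moment of order `α`
is at most `σ ^ α`. Unlike in `HeavyTailedOracle`, neither `g` nor `f` has to come from random
losses. -/
def IsHeavyTailedGradientOn (D : Measure Ξ) (g : Ξ → Vec d → Vec d) (f : Vec d → ℝ) (σ α : ℝ)
    (Q : Set (Vec d)) : Prop :=
  ∀ x ∈ Q,
    (Integrable (fun ξ => g ξ x) D ∧ ∫ ξ, g ξ x ∂D = ∇ f x) ∧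
    (Integrable (fun ξ => ‖g ξ x - ∇ f x‖ ^ α) D ∧ ∫ ξ, ‖g ξ x - ∇ f x‖ ^ α ∂D ≤ σ ^ α)

lemma measurable_clip_apply (hg : Measurable (Function.uncurry g)) {Z : Type*}
    [MeasurableSpace Z] {u : Z → Ξ} {v : Z → Vec d} (hu : Measurable u) (hv : Measurable v) :
    Measurable fun z => clip (g (u z) (v z)) lam :=
  measurable_clip.comp (hg.comp (hu.prodMk hv))

lemma measurable_clippedStep (hg : Measurable (Function.uncurry g)) :
    Measurable (clippedStep g γ lam) := by
  have hclip : Measurable fun z : Vec d × (Ξ × Vec d) => clip (g z.2.1 z.1) lam :=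
    measurable_clip_apply hg (by fun_prop) (by fun_prop)
  unfold clippedStep
  fun_prop

/-- The mean of the clipped stochastic gradient at `x`. -/
noncomputable def meanClip (D : Measure Ξ) (g : Ξ → Vec d → Vec d) (lam : ℝ) (x : Vec d) :
    Vec d :=
  ∫ ξ, clip (g ξ x) lam ∂D

/-- The fluctuation of the clipped stochastic gradient around its mean. -/
noncomputable def clipNoise (D : Measure Ξ) (g : Ξ → Vec d → Vec d) (lam : ℝ) (ξ : Ξ)
    (x : Vec d) : Vec d :=
  clip (g ξ x) lam - meanClip D g lam x

lemma clippedStep_eq_sub_smul (z : Vec d × (Ξ × Vec d)) : clippedStep g γ lam z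
    = z.1 - γ • (meanClip D g lam z.1 + clipNoise D g lam z.2.1 z.1 + z.2.2) := by
  rw [clippedStep, clipNoise, add_sub_cancel]

/-- The joint contribution of the clipping and the privacy noise of one step to the squared
distance to `xs`, set to zero when the step starts outside of the ball of radius `3 / 2 * R`. -/
noncomputable def localizedNoise (D : Measure Ξ) (g : Ξ → Vec d → Vec d) (xs : Vec d)
    (lam R γ : ℝ) : Vec d × (Ξ × Vec d) → ℝ :=
  (Prod.fst ⁻¹' Metric.closedBall xs (3 / 2 * R)).indicator fun z =>
    stepContribution γ (z.1 - xs) (clipNoise D g lam z.2.1 z.1)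
      + stepContribution γ (z.1 - xs) z.2.2

lemma localizedNoise_of_mem (hx : x ∈ Metric.closedBall xs (3 / 2 * R)) (y : Ξ × Vec d) :
    localizedNoise D g xs lam R γ (x, y) = stepContribution γ (x - xs) (clipNoise D g lam y.1 x)
      + stepContribution γ (x - xs) y.2 :=
  Set.indicator_of_mem (s := Prod.fst ⁻¹' Metric.closedBall xs (3 / 2 * R)) (a := (x, y)) hx _

lemma localizedNoise_of_notMem (hx : x ∉ Metric.closedBall xs (3 / 2 * R)) (y : Ξ × Vec d) :
    localizedNoise D g xs lam R γ (x, y) = 0 :=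
  Set.indicator_of_notMem (s := Prod.fst ⁻¹' Metric.closedBall xs (3 / 2 * R)) (a := (x, y)) hx _

variable [IsProbabilityMeasure D]

lemma measurable_meanClip (hg : Measurable (Function.uncurry g)) :
    Measurable (meanClip D g lam) := by
  have hclip : Measurable fun z : Vec d × Ξ => clip (g z.2 z.1) lam :=
    measurable_clip_apply hg measurable_snd measurable_fst
  exact hclip.stronglyMeasurable.integral_prod_right'.measurable

lemma measurable_clipNoise (hg : Measurable (Function.uncurry g)) {Z : Type*}
    [MeasurableSpace Z] {u : Z → Ξ} {v : Z → Vec d} (hu : Measurable u) (hv : Measurable v) :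
    Measurable fun z => clipNoise D g lam (u z) (v z) :=
  (measurable_clip_apply hg hu hv).sub ((measurable_meanClip hg).comp hv)

lemma measurable_localizedNoise (hg : Measurable (Function.uncurry g)) :
    Measurable (localizedNoise D g xs lam R γ) := by
  have hclip : Measurable fun z : Vec d × (Ξ × Vec d) => clipNoise D g lam z.2.1 z.1 :=
    measurable_clipNoise hg (by fun_prop) (by fun_prop)
  refine Measurable.indicator ?_ (measurable_fst measurableSet_closedBall)
  unfold stepContribution
  fun_prop

lemma norm_clipNoise_le (hlam : 0 < lam) (ξ : Ξ) (x : Vec d) :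
    ‖clipNoise D g lam ξ x‖ ≤ 2 * lam := by
  have hmean : ‖meanClip D g lam x‖ ≤ lam := by
    simpa [meanClip] using norm_integral_le_of_norm_le_const (μ := D)
      (.of_forall fun ξ => norm_clip_le hlam (g ξ x))
  calc _ ≤ ‖clip (g ξ x) lam‖ + ‖meanClip D g lam x‖ := norm_sub_le _ _
    _ ≤ 2 * lam := by linarith [norm_clip_le hlam (g ξ x)]

lemma integral_clipNoise (hx : AEStronglyMeasurable (fun ξ => g ξ x) D) (hlam : 0 < lam) :
    ∫ ξ, clipNoise D g lam ξ x ∂D = 0 := by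
  simp only [clipNoise]
  rw [integral_sub (integrable_clip hx hlam) (integrable_const _), integral_const, probReal_univ,
    one_smul, meanClip, sub_self]

namespace IsHeavyTailedGradientOn

variable {Q : Set (Vec d)}

lemma integral_norm_clipNoise_sq_le (hD : IsHeavyTailedGradientOn D g f σ α Q) (hx : x ∈ Q)
    (hlam : 0 < lam) (hα : 0 ≤ α) (hα2 : α ≤ 2) :
    ∫ ξ, ‖clipNoise D g lam ξ x‖ ^ 2 ∂D ≤ 4 * lam ^ (2 - α) * effNoise L R σ α lam := by
  obtain ⟨⟨hint, -⟩, hmoment, hle⟩ := hD x hx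
  refine (integral_norm_clip_sub_integral_sq_le _ hint.1 hlam hα hα2 hmoment hle).trans ?_
  gcongr
  exact rpow_le_effNoise

lemma norm_meanClip_sub_gradient_le
    (hD : IsHeavyTailedGradientOn D g f σ α (Metric.closedBall xs (2 * R)))
    (hf : IsSmoothConvexNear f xs L (2 * R)) (hL : 0 < L) (hR : 0 < R) (hσ : 0 < σ)
    (hα : 1 ≤ α) (hα2 : α ≤ 2) (hlam : 0 < lam) (hx : x ∈ Metric.closedBall xs (2 * R)) :
    ‖meanClip D g lam x - ∇ f x‖ ≤ 2 * clipBias L R σ α lam := by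
  obtain ⟨⟨hint, hmean⟩, hmoment, hle⟩ := hD x hx
  rw [← hmean] at hmoment hle
  have hgrad : ‖∫ ξ, g ξ x ∂D‖ ≤ lam / 2 + zeta L R lam :=
    calc ‖∫ ξ, g ξ x ∂D‖ ≤ L * ‖x - xs‖ := hmean ▸ hf.norm_gradient_le (by linarith) hx
      _ ≤ L * (2 * R) := by gcongr; exact mem_closedBall_iff_norm.1 hx
      _ = lam / 2 + (2 * L * R - lam / 2) := by ring
      _ ≤ lam / 2 + zeta L R lam := by gcongr; exact le_max_right _ _
  rw [← hmean]
  exact (norm_integral_clip_sub_integral_le hint hlam hα hα2 zeta_nonneg hgrad hmoment hle).trans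
    (zeta_add_le_two_mul_clipBias hL hR hσ hα hlam)

lemma lintegral_exp_localizedNoise_le
    (hD : IsHeavyTailedGradientOn D g f σ α (Metric.closedBall xs (2 * R)))
    (hg : Measurable (Function.uncurry g)) (hR : 0 < R) (hα : 0 ≤ α) (hα2 : α ≤ 2)
    (hlam : 0 < lam) (hd : 1 ≤ d) (hK : 1 ≤ K) (hl : 1 ≤ l)
    (hγ : IsSmallStep d K L R σ α lam σω l γ) (x : Vec d) :
    ∫⁻ y, ENNReal.ofReal (Real.exp (4 * l / R ^ 2 * localizedNoise D g xs lam R γ (x, y)))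
        ∂(D.prod (gaussianNoise d σω)) ≤ ENNReal.ofReal (Real.exp (l / K)) := by
  by_cases hx : x ∈ Metric.closedBall xs (3 / 2 * R)
  · have hx2 : x ∈ Metric.closedBall xs (2 * R) :=
      Metric.closedBall_subset_closedBall (by linarith) hx
    have hxR : ‖x - xs‖ ≤ 3 / 2 * R := mem_closedBall_iff_norm.1 hx
    have hθ : Measurable fun ξ => clipNoise D g lam ξ x :=
      measurable_clipNoise hg measurable_id measurable_const
    simp only [localizedNoise_of_mem hx, mul_add]
    rw [show l / K = l / (2 * K) + l / (2 * K) by field_simp; norm_num]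
    refine lintegral_exp_add_prod_le
      (f := fun ξ => 4 * l / R ^ 2 * stepContribution γ (x - xs) (clipNoise D g lam ξ x))
      (g := fun w => 4 * l / R ^ 2 * stepContribution γ (x - xs) w) ?_ ?_ ?_ ?_
    · unfold stepContribution
      fun_prop
    · unfold stepContribution
      fun_prop
    · exact lintegral_exp_stepContribution_le hθ.aestronglyMeasurable
        (fun ξ => norm_clipNoise_le hlam ξ x) (integral_clipNoise (hD x hx2).1.1.1 hlam)
        (hD.integral_norm_clipNoise_sq_le hx2 hlam hα hα2) hK hR hγ.pos.le hl hxR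
        hγ.sq_mul_variance_le hγ.mul_clipLevel_le
    · exact lintegral_exp_stepContribution_gaussianNoise_le hd hK hR hl hxR
        hγ.sq_mul_gaussianVariance_le
  · simp only [localizedNoise_of_notMem hx, mul_zero, Real.exp_zero, ENNReal.ofReal_one,
      lintegral_one, measure_univ]
    rw [ENNReal.one_le_ofReal]
    exact Real.one_le_exp (by positivity)

lemma bestValue_orbit_sub_le
    (hD : IsHeavyTailedGradientOn D g f σ α (Metric.closedBall xs (2 * R)))
    (hf : IsSmoothConvexNear f xs L (2 * R)) (hL : 0 < L) (hR : 0 < R) (hσ : 0 < σ)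
    (hα : 1 ≤ α) (hα2 : α ≤ 2) (hlam : 0 < lam) (hx₀ : ‖x₀ - xs‖ ≤ R) (hK : 1 ≤ K)
    (hγ : IsSmallStep d K L R σ α lam σω l γ) (y : ℕ → Ξ × Vec d)
    (hnoise : ∀ k ∈ Finset.Icc 1 K, ∑ j ∈ Finset.range k,
      localizedNoise D g xs lam R γ (orbit (clippedStep g γ lam) x₀ y j, y j) < R ^ 2 / 2) :
    bestValue f (orbit (clippedStep g γ lam) x₀ y) K - f xs ≤ (3 / 2 * R) ^ 2 / γ / K := by
  set X := orbit (clippedStep g γ lam) x₀ y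
  have hstep (k : ℕ) : X (k + 1) = X k
      - γ • (meanClip D g lam (X k) + clipNoise D g lam (y k).1 (X k) + (y k).2) :=
    clippedStep_eq_sub_smul (X k, y k)
  have hbias (k : ℕ) (hk : ‖X k - xs‖ ≤ 3 / 2 * R) :
      ‖meanClip D g lam (X k) - ∇ f (X k)‖ ≤ 2 * clipBias L R σ α lam :=
    hD.norm_meanClip_sub_gradient_le hf hL hR hσ hα hα2 hlam
      (mem_closedBall_iff_norm.2 (hk.trans (by linarith)))
  have hbias0 : 0 ≤ 2 * clipBias L R σ α lam := by linarith [clipBias_pos (α := α) hL hR hσ hlam]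
  have hnoise' (k : ℕ) (hk : k ≤ K) (hX : ∀ j < k, ‖X j - xs‖ ≤ 3 / 2 * R) :
      ∑ j ∈ Finset.range k, (stepContribution γ (X j - xs) (clipNoise D g lam (y j).1 (X j))
        + stepContribution γ (X j - xs) (y j).2) ≤ R ^ 2 / 2 := by
    rcases k.eq_zero_or_pos with rfl | hk0
    · rw [Finset.sum_range_zero]
      positivity
    · refine le_of_eq_of_le (Finset.sum_congr rfl fun j hj => ?_)
        (hnoise k (Finset.mem_Icc.2 ⟨hk0, hk⟩)).le
      rw [localizedNoise_of_mem (mem_closedBall_iff_norm.2 (hX j (Finset.mem_range.1 hj)))]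
  have hsum := hf.sum_gap_le (X := X) (G := fun k => meanClip D g lam (X k))
    (θ := fun k => clipNoise D g lam (y k).1 (X k)) (w := fun k => (y k).2) hL hR hx₀ hstep
    hγ.pos.le hγ.mul_smoothness_le hbias hbias0 (hγ.mul_bias_cost_le hL hR hσ hlam hK) hnoise'
  rw [← Finset.mul_sum, ← le_div_iff₀' hγ.pos] at hsum
  exact bestValue_sub_le_div f X hK hsum

variable {Ω : Type*} [MeasurableSpace Ω] {P : Measure Ω} [IsProbabilityMeasure P]
  {Y : ℕ → Ω → Ξ × Vec d}

lemma measure_exists_sum_localizedNoise_ge_le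
    (hD : IsHeavyTailedGradientOn D g f σ α (Metric.closedBall xs (2 * R)))
    (hg : Measurable (Function.uncurry g)) (hR : 0 < R) (hα : 0 ≤ α) (hα2 : α ≤ 2)
    (hlam : 0 < lam) (x₀ : Vec d) (hd : 1 ≤ d) (hK : 1 ≤ K) (hl : 1 ≤ l)
    (hγ : IsSmallStep d K L R σ α lam σω l γ) (hY : ∀ k, Measurable (Y k))
    (hlaw : ∀ k, HasLaw (Y k) (D.prod (gaussianNoise d σω)) P) (hind : iIndepFun Y P) :
    P {ω | ∃ k ∈ Finset.Icc 1 K, R ^ 2 / 2 ≤ ∑ j ∈ Finset.range k, localizedNoise D g xs lam R γ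
        (orbit (clippedStep g γ lam) x₀ (fun i => Y i ω) j, Y j ω)}
      ≤ ENNReal.ofReal (K * Real.exp (-l)) := by
  have : (0 : ℝ) < K := by exact_mod_cast hK
  have hthreshold (S : ℝ) : K * (l / K) + l ≤ 4 * l / R ^ 2 * S ↔ R ^ 2 / 2 ≤ S := by
    rw [show K * (l / K) + l = 4 * l / R ^ 2 * (R ^ 2 / 2) by field_simp; norm_num,
      mul_le_mul_iff_right₀ (by positivity)]
  simp only [← hthreshold, Finset.mul_sum]
  exact measure_exists_sum_orbit_ge_le hY (fun k => (hlaw k).map_eq) hind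
    (measurable_clippedStep hg) x₀ (Z := fun z => 4 * l / R ^ 2 * localizedNoise D g xs lam R γ z)
    ((measurable_localizedNoise hg).const_mul _) (by positivity)
    (hD.lintegral_exp_localizedNoise_le hg hR hα hα2 hlam hd hK hl hγ) K l

theorem ofReal_one_sub_le_measure_bestValue_sub_le
    (hD : IsHeavyTailedGradientOn D g f σ α (Metric.closedBall xs (2 * R)))
    (hf : IsSmoothConvexNear f xs L (2 * R)) (hg : Measurable (Function.uncurry g))
    (hL : 0 < L) (hR : 0 < R) (hσ : 0 < σ) (hα : 1 ≤ α) (hα2 : α ≤ 2) (hlam : 0 < lam)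
    (hx₀ : ‖x₀ - xs‖ ≤ R) (hd : 1 ≤ d) (hK : 1 ≤ K) (hl : 1 ≤ l)
    (hγ : IsSmallStep d K L R σ α lam σω l γ) (hY : ∀ k, Measurable (Y k))
    (hlaw : ∀ k, HasLaw (Y k) (D.prod (gaussianNoise d σω)) P) (hind : iIndepFun Y P) :
    ENNReal.ofReal (1 - K * Real.exp (-l)) ≤
      P {ω | bestValue f (orbit (clippedStep g γ lam) x₀ fun k => Y k ω) K - f xs
        ≤ (3 / 2 * R) ^ 2 / γ / K} := by
  set bad := {ω | ∃ k ∈ Finset.Icc 1 K, R ^ 2 / 2 ≤ ∑ j ∈ Finset.range k,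
    localizedNoise D g xs lam R γ (orbit (clippedStep g γ lam) x₀ (fun i => Y i ω) j, Y j ω)}
  have hbad : P bad ≤ ENNReal.ofReal (K * Real.exp (-l)) :=
    hD.measure_exists_sum_localizedNoise_ge_le hg hR (by linarith) hα2 hlam x₀ hd hK hl hγ hY hlaw
      hind
  have hgood : badᶜ ⊆ {ω | bestValue f (orbit (clippedStep g γ lam) x₀ fun k => Y k ω) K - f xs
      ≤ (3 / 2 * R) ^ 2 / γ / K} := fun ω hω =>
    hD.bestValue_orbit_sub_le hf hL hR hσ hα hα2 hlam hx₀ hK hγ _ fun k hk =>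
      not_le.1 fun hle => hω ⟨k, hk, hle⟩
  rw [ENNReal.ofReal_sub _ (by positivity), ENNReal.ofReal_one, tsub_le_iff_left]
  calc 1 = P (bad ∪ badᶜ) := by rw [Set.union_compl_self, measure_univ]
    _ ≤ P bad + P badᶜ := measure_union_le _ _
    _ ≤ _ := add_le_add hbad (measure_mono hgood)

end IsHeavyTailedGradientOn

end HighProbability

section ErrorBound

variable {d K : ℕ} {f : Vec d → ℝ} {xs x₀ : Vec d} {L R σ α lam β ε δ σω a : ℝ}

lemma bestValue_le_zero (f : Vec d → ℝ) (X : ℕ → Vec d) (K : ℕ) : bestValue f X K ≤ f (X 0) :=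
  Finset.inf'_le _ (Finset.mem_range.2 K.succ_pos)

lemma IsSmoothConvexNear.gap_le_two_mul_errorBound (hf : IsSmoothConvexNear f xs L (2 * R))
    (hL : 0 < L) (hx₀ : ‖x₀ - xs‖ ≤ R) (hK : 1 ≤ K) (hsmall : K ≤ 2 ∨ R = 0) :
    f x₀ - f xs ≤ 2 * errorBound d K L R σ α lam β ε δ := by
  rcases (norm_nonneg _ |>.trans hx₀).eq_or_lt' with rfl | hR
  · rw [sub_eq_zero.1 (norm_le_zero_iff.1 hx₀), sub_self]
    exact mul_nonneg two_pos.le (errorBound_nonneg hL)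
  have : (0 : ℝ) < K := by exact_mod_cast hK
  have hK2 : (K : ℝ) ≤ 2 := by exact_mod_cast hsmall.resolve_right hR.ne'
  calc f x₀ - f xs ≤ L * ‖x₀ - xs‖ ^ 2 :=
        hf.gap_le (by positivity) (mem_closedBall_iff_norm.2 (by linarith))
    _ ≤ L * R ^ 2 := by gcongr
    _ = 2 * (L * R ^ 2 / 2) := by ring
    _ ≤ 2 * (L * R ^ 2 / K) := by gcongr
    _ ≤ 2 * detTerm K L R lam := by
        rw [detTerm]
        gcongr
        exact le_add_of_nonneg_right (by positivity)
    _ ≤ 2 * errorBound d K L R σ α lam β ε δ := by gcongr; exact detTerm_le_errorBound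

lemma one_le_log_natCast_div (hK : 3 ≤ K) (hβ : 0 < β) (hβ1 : β ≤ 1) : 1 ≤ Real.log (K / β) := by
  have hK3 : (3 : ℝ) ≤ K := by exact_mod_cast hK
  rw [Real.le_log_iff_exp_le (by positivity)]
  calc Real.exp 1 ≤ 3 := Real.exp_one_lt_three.le
    _ ≤ K := hK3
    _ ≤ K / β := le_div_self (by positivity) hβ hβ1

lemma natCast_mul_exp_neg_log_div (hK : 1 ≤ K) (hβ : 0 < β) :
    K * Real.exp (-Real.log (K / β)) = β := by
  have hK0 : (0 : ℝ) < K := by exact_mod_cast hK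
  rw [Real.exp_neg, Real.exp_log (by positivity), inv_div, mul_div_cancel₀ _ hK0.ne']

lemma sq_div_mul_stepSizeMin_div_le (hL : 0 < L) (hR : 0 < R) (hσ : 0 < σ) (hlam : 0 < lam)
    (hd : 1 ≤ d) (hK : 1 ≤ K) (hl : 0 < Real.log (K / β)) (hσω : 0 < σω) {c : ℝ} (hc : 0 ≤ c)
    (hε : 0 < ε) (hδ : 0 < δ) (hδ1 : δ < 1) (ha : 0 ≤ a) (hup : σω ≤ a * dpScale K lam ε δ) :
    (3 / 2 * R) ^ 2 / (c * stepSizeMin d K L R σ α lam β σω) / K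
      ≤ 9 / 4 / c * ((1 + a) * errorBound d K L R σ α lam β ε δ) :=
  calc _ = 9 / 4 / c * (R ^ 2 / (stepSizeMin d K L R σ α lam β σω * K)) := by ring
    _ ≤ _ := by
        gcongr
        exact sq_div_stepSizeMin_mul_le hL hR hσ hlam hd hK hl hσω hε hδ hδ1 ha hup

end ErrorBound

end DPClippedSGD

open DPClippedSGD in
theorem mainTheorem4_general {d K : ℕ} {Ξ : Type*} [MeasurableSpace Ξ] {D : Measure Ξ}
    [IsProbabilityMeasure D] {g : Ξ → Vec d → Vec d} {f : Vec d → ℝ} {x₀ xs : Vec d}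
    {L R σ α lam β ε δ σω A a c : ℝ} {Ω : Type*} [MeasurableSpace Ω] {P : Measure Ω}
    [IsProbabilityMeasure P] {Y : ℕ → Ω → Ξ × Vec d}
    (hA : 0 ≤ A) (hc : 0 < c) (hcA : c * max 1 A ≤ 1 / 100) (ha : 0 ≤ a) (hd : 1 ≤ d)
    (hg : Measurable (Function.uncurry g)) (hL : 0 < L) (hσ : 0 < σ) (hα : 1 ≤ α) (hα2 : α ≤ 2)
    (hx₀ : ‖x₀ - xs‖ ≤ R) (hf : IsSmoothConvexNear f xs L (2 * R))
    (hD : IsHeavyTailedGradientOn D g f σ α (Metric.closedBall xs (2 * R))) (hK : 1 ≤ K)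
    (hβ : 0 < β) (hβ1 : β ≤ 1) (hlam : 0 < lam) (hε : 0 < ε) (hδ : 0 < δ) (hδ1 : δ < 1)
    (hlamA : lam ^ α * Real.log (K / β) ≤ A ^ α * K * effNoise L R σ α lam) (hσω : 0 < σω)
    (hσωa : σω ≤ a * dpScale K lam ε δ) (hY : ∀ k, Measurable (Y k))
    (hlaw : ∀ k, HasLaw (Y k) (D.prod (gaussianNoise d σω)) P) (hind : iIndepFun Y P) :
    ENNReal.ofReal (1 - β) ≤
      P {ω | bestValue f (orbit (clippedStep g (c * stepSizeMin d K L R σ α lam β σω) lam) x₀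
            fun k => Y k ω) K - f xs
          ≤ (2 + 9 / 4 / c * (1 + a)) * errorBound d K L R σ α lam β ε δ} := by
  have hE : 0 ≤ errorBound d K L R σ α lam β ε δ := errorBound_nonneg hL
  have hca : 0 ≤ 9 / 4 / c * (1 + a) := by positivity
  by_cases hsmall : K ≤ 2 ∨ R = 0
  · have hgap (ω : Ω) := calc
      _ ≤ f x₀ - f xs := sub_le_sub_right (bestValue_le_zero f
        (orbit (clippedStep g (c * stepSizeMin d K L R σ α lam β σω) lam) x₀ fun k => Y k ω) K) _
      _ ≤ 2 * errorBound d K L R σ α lam β ε δ :=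
        hf.gap_le_two_mul_errorBound hL hx₀ hK hsmall
      _ ≤ (2 + 9 / 4 / c * (1 + a)) * errorBound d K L R σ α lam β ε δ := by gcongr; linarith
    exact ((ENNReal.ofReal_le_one.2 (by linarith)).trans_eq measure_univ.symm).trans
      (measure_mono fun ω _ => hgap ω)
  obtain ⟨hK2, hR0⟩ := not_or.1 hsmall
  have hR : 0 < R := ((norm_nonneg _).trans hx₀).lt_of_ne' hR0
  have hl := one_le_log_natCast_div (not_le.1 hK2) hβ hβ1
  have hl0 : 0 < Real.log (K / β) := by linarith
  have hmin : 0 < stepSizeMin d K L R σ α lam β σω := stepSizeMin_pos hL hR hσ hlam hd hK hl0 hσω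
  have hstep := isSmallStep_of_le hL hR hσ (by linarith) hα2 hlam hd hK hl0 hσω hA hc.le hcA hlamA
    (mul_pos hc hmin) le_rfl
  have hrate : (3 / 2 * R) ^ 2 / (c * stepSizeMin d K L R σ α lam β σω) / K
      ≤ (2 + 9 / 4 / c * (1 + a)) * errorBound d K L R σ α lam β ε δ :=
    calc _ ≤ 9 / 4 / c * ((1 + a) * errorBound d K L R σ α lam β ε δ) :=
          sq_div_mul_stepSizeMin_div_le hL hR hσ hlam hd hK hl0 hσω hc.le hε hδ hδ1 ha hσωa
      _ ≤ _ := by linarith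
  have hprob := hD.ofReal_one_sub_le_measure_bestValue_sub_le hf hg hL hR hσ hα hα2 hlam hx₀ hd hK
    hl hstep hY hlaw hind
  rw [natCast_mul_exp_neg_log_div hK hβ] at hprob
  exact hprob.trans (measure_mono fun ω hω => le_trans hω hrate)

/-- Order of quantifiers: `A` is the constant in the admissible range of clipping levels, `c` the
constant in the choice of the step-size, `a₁, a₂` those in `σω = Θ(…)`, `C` the one in the final
bound; all are chosen before, and so do not depend on, the problem and the other parameters. -/
theorem mainTheorem4 :
    ∀ A : ℝ, 0 < A → ∃ c₀ : ℝ, 0 < c₀ ∧ ∀ c : ℝ, 0 < c → c ≤ c₀ →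
    ∀ a₁ a₂ : ℝ, 0 < a₁ → a₁ ≤ a₂ → ∃ C : ℝ, 0 < C ∧
    -- the problem
    ∀ (d : ℕ) (_ : 1 ≤ d)
      (Ξ : Type*) (_ : MeasurableSpace Ξ) (D : Measure Ξ) (_ : IsProbabilityMeasure D)
      (ℓ : Ξ → DPClippedSGD.Vec d → ℝ)
      (_ : Measurable (Function.uncurry ℓ))
      (_ : Measurable (fun p : Ξ × DPClippedSGD.Vec d => ∇ (ℓ p.1) p.2))
      (_ : ∀ x, Integrable (fun ξ => ℓ ξ x) D)
      (x₀ xstar : DPClippedSGD.Vec d) (L R σ α : ℝ)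
      (_ : 0 < L) (_ : 0 < σ) (_ : 1 < α) (_ : α ≤ 2) (_ : ‖x₀ - xstar‖ ≤ R)
      -- the assumptions on the ball of radius `2 R` around the minimizer `xstar`
      (_ : IsMinOn (DPClippedSGD.objective D ℓ) (Metric.closedBall xstar (2 * R)) xstar)
      (_ : DPClippedSGD.SmoothOn (DPClippedSGD.objective D ℓ) L
        (Metric.closedBall xstar (2 * R)))
      (_ : DPClippedSGD.FirstOrderConvexOn (DPClippedSGD.objective D ℓ)
        (Metric.closedBall xstar (2 * R)))
      (_ : DPClippedSGD.HeavyTailedOracle D ℓ σ α (Metric.closedBall xstar (2 * R)))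
      -- the parameters of the method
      (K : ℕ) (β lam ε δ σω γ : ℝ)
      (_ : 1 ≤ K) (_ : 0 < β) (_ : β ≤ 1) (_ : 0 < lam) (_ : 0 < ε) (_ : 0 < δ) (_ : δ < 1)
      (_ : lam ^ α * Real.log (K / β) ≤ A ^ α * K * DPClippedSGD.effNoise L R σ α lam)
      (_ : a₁ * DPClippedSGD.dpScale K lam ε δ ≤ σω)
      (_ : σω ≤ a₂ * DPClippedSGD.dpScale K lam ε δ)
      (_ : γ = c * DPClippedSGD.stepSizeMin d K L R σ α lam β σω)
      -- the samples and the DP noise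
      (Ω : Type*) (_ : MeasurableSpace Ω) (P : Measure Ω) (_ : IsProbabilityMeasure P)
      (ξ : ℕ → Ω → Ξ) (w : ℕ → Ω → DPClippedSGD.Vec d)
      (_ : ∀ k, Measurable (ξ k)) (_ : ∀ k, Measurable (w k))
      (_ : ∀ k, HasLaw (fun ω => (ξ k ω, w k ω))
        (D.prod (DPClippedSGD.gaussianNoise d σω)) P)
      (_ : iIndepFun (fun k ω => (ξ k ω, w k ω)) P),
      ENNReal.ofReal (1 - β) ≤
        P {ω | DPClippedSGD.bestValue (DPClippedSGD.objective D ℓ)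
              (DPClippedSGD.iterate ℓ γ lam x₀ (fun k => ξ k ω) (fun k => w k ω)) K
            - DPClippedSGD.objective D ℓ xstar ≤
          C * max (max (DPClippedSGD.detTerm K L R lam)
                (DPClippedSGD.stochTerm K L R σ α lam β))
              (max (DPClippedSGD.biasTerm L R σ α lam)
                (DPClippedSGD.dpTerm d K L R lam β ε δ))} := by
  intro A hA
  refine ⟨1 / (100 * max 1 A), by positivity, fun c hc hc₀ a₁ a₂ ha₁ ha₁₂ => ?_⟩
  have hcA : c * max 1 A ≤ 1 / 100 :=
    calc c * max 1 A ≤ 1 / (100 * max 1 A) * max 1 A := by gcongr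
      _ = 1 / 100 := by field_simp
  have ha₂ : 0 < a₂ := ha₁.trans_le ha₁₂
  refine ⟨2 + 9 / 4 / c * (1 + a₂), by positivity, ?_⟩
  intro d hd Ξ _ D _ ℓ _ hg _ x₀ xstar L R σ α hL hσ hα hα2 hx₀ hmin hsmooth hconv hD K β lam ε δ
    σω γ hK hβ hβ1 hlam hε hδ hδ1 hlamA hlow hup hγ Ω _ P _ ξ w hξ hw hlaw hind
  have hσω : 0 < σω := (mul_pos ha₁ (DPClippedSGD.dpScale_pos hK hlam hε hδ hδ1)).trans_le hlow
  simp only [hγ, DPClippedSGD.iterate_eq_orbit]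
  exact mainTheorem4_general hA.le hc hcA ha₂.le hd hg hL hσ hα.le hα2 hx₀
    ⟨hmin, hsmooth, hconv⟩ hD hK hβ hβ1 hlam hε hδ hδ1 hlamA hσω hup
    (fun k => (hξ k).prodMk (hw k)) hlaw hind
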